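/- Notation. Let $n\ge 1$. A function $g:(0,\infty)\to(0,\infty)$ is almost decreasing if there is $C>0$ with $g(r)\ge C g(s)$ for all $0<r\le s$, and almost increasing if there is $C>0$ with $g(r)\le C g(s)$ for all $0<r\le s$. For $1\le p<\infty$, a measurable $\phi:(0,\infty)\to(0,\infty)$ is of class $\mathcal G_p$ if $\phi$ is almost decreasing and $\phi^p(r)r^n$ is almost increasing. The generalized Morrey space $L^{p,\phi}(\mathbb R^n)$ consists of all (real- or complex-valued) $f\in L^p_{\rm loc}(\mathbb R^n)$ with $$\|f\|_{L^{p,\phi}}:=\sup_{B=B(a,r)}\frac1{\phi(r)}\left(\frac1{|B|}\int_B|f(x)|^p\,dx\right)^{1/p}<\infty ,$$ and $\|f\|_{L^{p,q}}:=\sup_{B=B(a,r)}|B|^{\frac1q-\frac1p}\left(\int_B|f(x)|^p\,dx\right)^{1/p}$, the suprema being over all $a\in\mathbb R^n$ and $r>0$. For $0<\alpha<n$ and $\gamma\ge0$ put $$K_{\alpha,\gamma}(x):=\frac{|x|^{\alpha-n}}{(1+|x|)^\gamma},\qquad I_{\alpha,\gamma}f(x):=\int_{\mathbb R^n}K_{\alpha,\gamma}(x-y)f(y)\,dy,$$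 and $K_\alpha:=K_{\alpha,0}$, $I_\alpha:=I_{\alpha,0}$ (the fractional integral operator). Let $\|T\|_{X\to Y}:=\sup_{f\ne0}\|Tf\|_Y/\|f\|_X$, and let $s'$, $t'$ denote the dual exponents of $s$, $t$. Theorem 3.1. Let $0<\alpha<n$, $\gamma\ge0$, $1\le p_1<\frac n\alpha$, and let $\phi$ be of class $\mathcal G_{p_1}$ such that $\phi(r)r^n$ is almost increasing. Suppose that either (a) $1\le p_1<t$ and $1<s<t=\frac n{n-\alpha}$, or (b) $\gamma>0$, $1\le p_1\le t$, $1<s\le t$ and $\frac n{n+\gamma-\alpha}<t<\frac n{n-\alpha}$, and that there are constants $C_1,C_2,C_3>0$ such that for every $R>0$ (i) $\int_R^\infty\phi(r)r^{\frac n{t'}-1}\,dr\le C_1\,\phi(R)R^{\frac n{t'}}$, (ii) $\int_0^R\phi^{p_1}(r)r^{n-1}\,dr\le C_2\,\phi^{p_1}(R)R^n$, (iii) $\int_0^R\frac{r^{n-1}}{\phi^{s'}(r)r^{ns'}}\,dr\le\frac{C_3R^n}{\phi^{s'}(R)R^{ns'}}$. Let $\frac1{p_2}=\frac1{p_1}-\frac1{s'}$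 and $\psi(r):=\phi(r)r^{\frac n{t'}}$. Then $\|K_{\alpha,\gamma}\|_{L^{s,t}}<\infty$; for every $f\in L^{p_1,\phi}$ the integral defining $I_{\alpha,\gamma}f(x)$ converges absolutely for almost every $x$, and $I_{\alpha,\gamma}f\in L^{p_2,\psi}$; and $$C_4\|K_{\alpha,\gamma}\|_{L^{p_1,t}}\le\|I_{\alpha,\gamma}\|_{L^{p_1,\phi}\to L^{p_2,\psi}}\le C_5\|K_{\alpha,\gamma}\|_{L^{s,t}},$$ where $C_4,C_5>0$ depend on $\phi,n,p_1,s,t$ but not on $\alpha$ and $\gamma$. In particular, for $\gamma=0$ and under (a), $$C_4\|K_\alpha\|_{L^{p_1,t}}\le\|I_\alpha\|_{L^{p_1,\phi}\to L^{p_2,\psi}}\le C_5\|K_\alpha\|_{L^{s,t}}.$$ -/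

import Mathlib

open MeasureTheory Set
open scoped ENNReal

noncomputable section

/-- `g` is almost decreasing on `(0, ∞)`. -/
def AlmostDecreasing (g : ℝ → ℝ) : Prop :=
  ∃ C : ℝ, 0 < C ∧ ∀ r s : ℝ, 0 < r → r ≤ s → C * g s ≤ g r

/-- `g` is almost increasing on `(0, ∞)`. -/
def AlmostIncreasing (g : ℝ → ℝ) : Prop :=
  ∃ C : ℝ, 0 < C ∧ ∀ r s : ℝ, 0 < r → r ≤ s → g r ≤ C * g s

/-- `φ : (0, ∞) → (0, ∞)` is of class `𝒢_p` (in dimension `n`). Only the values of `φ` on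
`(0, ∞)` matter; `φ` is (Lebesgue) measurable there. -/
structure IsClassG (n : ℕ) (p : ℝ) (φ : ℝ → ℝ) : Prop where
  pos : ∀ r : ℝ, 0 < r → 0 < φ r
  aemeasurable : AEMeasurable φ (volume.restrict (Ioi (0 : ℝ)))
  almostDecreasing : AlmostDecreasing φ
  almostIncreasing : AlmostIncreasing fun r => φ r ^ p * r ^ (n : ℝ)

section Morrey

variable {n : ℕ} {F : Type*} [NormedAddCommGroup F]

/-- `f ∈ L^p_loc(ℝⁿ)`. -/
def MemLpLoc (p : ℝ) (f : EuclideanSpace ℝ (Fin n) → F) : Prop :=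
  ∀ A : Set (EuclideanSpace ℝ (Fin n)), IsCompact A →
    MemLp f (ENNReal.ofReal p) (volume.restrict A)

/-- The generalized Morrey norm
`sup_{B = B(a,r)} φ(r)⁻¹ (|B|⁻¹ ∫_B |f|^p)^{1/p}`, with values in `[0, ∞]`. -/
def genMorreyNorm (p : ℝ) (φ : ℝ → ℝ) (f : EuclideanSpace ℝ (Fin n) → F) : ℝ≥0∞ :=
  ⨆ (a : EuclideanSpace ℝ (Fin n)) (r : ℝ) (_ : 0 < r),
    (ENNReal.ofReal (φ r))⁻¹ *
      ((volume (Metric.ball a r))⁻¹ * ∫⁻ x in Metric.ball a r, ‖f x‖ₑ ^ p) ^ (1 / p)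

/-- `f` belongs to the generalized Morrey space `L^{p,φ}(ℝⁿ)`. -/
def MemGenMorrey (p : ℝ) (φ : ℝ → ℝ) (f : EuclideanSpace ℝ (Fin n) → F) : Prop :=
  MemLpLoc p f ∧ genMorreyNorm p φ f < ∞

/-- The classical Morrey norm
`sup_{B = B(a,r)} |B|^{1/q - 1/p} (∫_B |f|^p)^{1/p}`, with values in `[0, ∞]`. -/
def morreyNorm (p q : ℝ) (f : EuclideanSpace ℝ (Fin n) → F) : ℝ≥0∞ :=
  ⨆ (a : EuclideanSpace ℝ (Fin n)) (r : ℝ) (_ : 0 < r),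
    volume (Metric.ball a r) ^ (1 / q - 1 / p) *
      (∫⁻ x in Metric.ball a r, ‖f x‖ₑ ^ p) ^ (1 / p)

/-- The operator norm `sup_{f ≠ 0} ‖T f‖ / ‖f‖` from `L^{p₁,φ}` to `L^{p₂,ψ}`; here `f ≠ 0` is
meant almost everywhere, that is, `‖f‖ ≠ 0`. -/
def morreyOpNorm (p₁ : ℝ) (φ : ℝ → ℝ) (p₂ : ℝ) (ψ : ℝ → ℝ)
    (T : (EuclideanSpace ℝ (Fin n) → F) → (EuclideanSpace ℝ (Fin n) → F)) : ℝ≥0∞ :=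
  ⨆ (f : EuclideanSpace ℝ (Fin n) → F) (_ : MemGenMorrey p₁ φ f)
    (_ : genMorreyNorm p₁ φ f ≠ 0), genMorreyNorm p₂ ψ (T f) / genMorreyNorm p₁ φ f

end Morrey

/-- The Bessel-Riesz kernel `K_{α,γ}(x) = |x|^{α-n} / (1+|x|)^γ`. -/
def besselRieszKernel {n : ℕ} (α γ : ℝ) (x : EuclideanSpace ℝ (Fin n)) : ℝ :=
  ‖x‖ ^ (α - n) / (1 + ‖x‖) ^ γ

/-- The kernel `K_α(x) = |x|^{α-n}` of the fractional integral operator. -/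
def rieszKernel {n : ℕ} (α : ℝ) (x : EuclideanSpace ℝ (Fin n)) : ℝ :=
  ‖x‖ ^ (α - n)

section Operators

variable {n : ℕ} {𝕜 : Type*} [RCLike 𝕜]

/-- The Bessel-Riesz operator `I_{α,γ} f (x) = ∫ K_{α,γ}(x-y) f(y) dy`. -/
def besselRiesz (α γ : ℝ) (f : EuclideanSpace ℝ (Fin n) → 𝕜) : EuclideanSpace ℝ (Fin n) → 𝕜 :=
  fun x => ∫ y, besselRieszKernel α γ (x - y) • f y

/-- The fractional integral operator `I_α f (x) = ∫ K_α(x-y) f(y) dy`. -/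
def fractionalIntegral (α : ℝ) (f : EuclideanSpace ℝ (Fin n) → 𝕜) :
    EuclideanSpace ℝ (Fin n) → 𝕜 :=
  fun x => ∫ y, rieszKernel α (x - y) • f y

end Operators

end

/-!
A radially decreasing kernel `K` decays like `|x|^{-n/t}`, with constant a multiple of its Morrey
norm in `L^{s,t}`: average `|K|^s` over the ball `B(0,|x|)`. On a ball `B(a,R)` split `K * f`
at `B(a,2R)`. There only `K` on `B(0,3R)` matters, and Young's inequality bounds this part by the
`L^p` norm of `f` and the `L^s` norm of `K` on these two balls. For the rest use the decay of `K`,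
write `|x-y|^{-n/t}` as an integral over the balls `B(x,r)` with `r > |x-y|`, and apply (i).

Conversely, testing the operator on the indicator of `B(0,|z|/2)` bounds `K(z)` by the operator norm
times `|z|^{-n/t}`, and `|x|^{-n/t}` lies in `L^{p,t}` as soon as `p < t`. In fact `p₁ < s`: if
`s ≤ p₁`, then for every `r ≤ 1` one of the integrands in (ii) and (iii) is at least `1/r`, so (ii)
and (iii) at `R = 1` contradict the divergence of `∫₀¹ dr/r`.
-/

noncomputable section

open Metric

section Young

variable {G : Type*} [AddGroup G] [MeasurableSpace G] [MeasurableAdd₂ G] [MeasurableNeg G]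
  {μ : Measure G} [μ.IsAddLeftInvariant] {f g : G → ℝ≥0∞} {p q s : ℝ}

theorem lintegral_lconvolution [SFinite μ] (hf : AEMeasurable f μ) (hg : AEMeasurable g μ) :
    ∫⁻ x, (f ⋆ₗ[μ] g) x ∂μ = (∫⁻ x, f x ∂μ) * ∫⁻ x, g x ∂μ := by
  simp only [lconvolution_def]
  rw [lintegral_lintegral_swap (by fun_prop)]
  calc ∫⁻ y, ∫⁻ x, f y * g (-y + x) ∂μ ∂μ = ∫⁻ y, f y * ∫⁻ x, g x ∂μ ∂μ := by
        refine lintegral_congr fun y => ?_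
        have hgy : AEMeasurable (fun x => g (-y + x)) μ := hg.comp_quasiMeasurePreserving
          (measurePreserving_add_left μ (-y)).quasiMeasurePreserving
        rw [lintegral_const_mul'' _ hgy, lintegral_add_left_eq_self g (-y)]
    _ = (∫⁻ x, f x ∂μ) * ∫⁻ x, g x ∂μ := lintegral_mul_const'' _ hf

theorem mul_eq_young_factorization (hp : 1 ≤ p) (hs : 1 ≤ s) (hq : 0 < q)
    (hpqs : 1 / q = 1 / p + 1 / s - 1) (a b : ℝ≥0∞) :
    a * b = (a ^ p * b ^ s) ^ (1 / q) * (a ^ p) ^ (1 - 1 / s) * (b ^ s) ^ (1 - 1 / p) := by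
  have hp₀ : 0 < p := by linarith
  have hs₀ : 0 < s := by linarith
  have hp₁ : 0 ≤ 1 - 1 / p := sub_nonneg.2 ((div_le_one hp₀).2 hp)
  have hs₁ : 0 ≤ 1 - 1 / s := sub_nonneg.2 ((div_le_one hs₀).2 hs)
  have hq₁ : 0 ≤ 1 / q := by positivity
  have ha : p * (1 / q) + p * (1 - 1 / s) = 1 := by rw [hpqs]; field_simp; ring
  have hb : s * (1 / q) + s * (1 - 1 / p) = 1 := by rw [hpqs]; field_simp; ring
  rw [ENNReal.mul_rpow_of_nonneg _ _ hq₁, mul_assoc, mul_mul_mul_comm]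
  simp only [← ENNReal.rpow_mul]
  rw [← ENNReal.rpow_add_of_nonneg _ _ (by positivity) (by positivity),
    ← ENNReal.rpow_add_of_nonneg _ _ (by positivity) (by positivity), ha, hb, ENNReal.rpow_one,
    ENNReal.rpow_one]

theorem lconvolution_le_of_young_exponents [μ.IsNegInvariant] (hf : AEMeasurable f μ)
    (hg : AEMeasurable g μ) (hp : 1 ≤ p) (hs : 1 ≤ s) (hq : 0 < q)
    (hpqs : 1 / q = 1 / p + 1 / s - 1) (x : G) :
    (f ⋆ₗ[μ] g) x ≤ ((fun y => f y ^ p) ⋆ₗ[μ] fun y => g y ^ s) x ^ (1 / q) *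
      (∫⁻ y, f y ^ p ∂μ) ^ (1 - 1 / s) * (∫⁻ y, g y ^ s ∂μ) ^ (1 - 1 / p) := by
  have hp₁ : 1 / p ≤ 1 := (div_le_one (by linarith)).2 hp
  have hs₁ : 1 / s ≤ 1 := (div_le_one (by linarith)).2 hs
  have hgx : AEMeasurable (fun y => g (-y + x)) μ := by
    simpa only [Function.comp_def, neg_add_rev, neg_neg] using
      hg.comp_quasiMeasurePreserving (((Measure.measurePreserving_neg μ).comp
        (measurePreserving_add_left μ (-x))).quasiMeasurePreserving)
  have hinv : ∫⁻ y, g (-y + x) ^ s ∂μ = ∫⁻ y, g y ^ s ∂μ := by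
    rw [← lintegral_neg_eq_self fun y => g y ^ s,
      ← lintegral_add_left_eq_self (fun y => g (-y) ^ s) (-x)]
    simp only [neg_add_rev, neg_neg]
  have hölder := ENNReal.lintegral_prod_norm_pow_le (μ := μ) (Finset.univ : Finset (Fin 3))
    (f := ![fun y => f y ^ p * g (-y + x) ^ s, fun y => f y ^ p, fun y => g (-y + x) ^ s])
    (p := ![1 / q, 1 - 1 / s, 1 - 1 / p])
    (fun i _ => by
      fin_cases i
      exacts [(hf.pow_const p).mul (hgx.pow_const s), hf.pow_const p, hgx.pow_const s])
    (by rw [Fin.sum_univ_three]; change 1 / q + (1 - 1 / s) + (1 - 1 / p) = 1; linarith)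
    (fun i _ => by
      fin_cases i
      exacts [(one_div_pos.2 hq).le, sub_nonneg.2 hs₁, sub_nonneg.2 hp₁])
  simp only [Fin.prod_univ_three, Matrix.cons_val_zero, Matrix.cons_val_one, Matrix.cons_val,
    hinv] at hölder
  calc (f ⋆ₗ[μ] g) x = _ :=
        lintegral_congr fun y => mul_eq_young_factorization hp hs hq hpqs (f y) (g (-y + x))
    _ ≤ _ := hölder

theorem lintegral_lconvolution_rpow_le [SFinite μ] [μ.IsNegInvariant] (hf : AEMeasurable f μ)
    (hg : AEMeasurable g μ) (hp : 1 ≤ p) (hs : 1 ≤ s) (hq : 0 < q)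
    (hpqs : 1 / q = 1 / p + 1 / s - 1) :
    (∫⁻ x, (f ⋆ₗ[μ] g) x ^ q ∂μ) ^ (1 / q) ≤
      (∫⁻ x, f x ^ p ∂μ) ^ (1 / p) * (∫⁻ x, g x ^ s ∂μ) ^ (1 / s) := by
  have hp₁ : 1 / p ≤ 1 := (div_le_one (by linarith)).2 hp
  have hs₁ : 1 / s ≤ 1 := (div_le_one (by linarith)).2 hs
  have hq₁ : 0 ≤ 1 / q := by positivity
  set A := ∫⁻ x, f x ^ p ∂μ
  set B := ∫⁻ x, g x ^ s ∂μ
  calc (∫⁻ x, (f ⋆ₗ[μ] g) x ^ q ∂μ) ^ (1 / q)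
      ≤ (∫⁻ x, ((fun y => f y ^ p) ⋆ₗ[μ] fun y => g y ^ s) x *
          (A ^ (1 - 1 / s) * B ^ (1 - 1 / p)) ^ q ∂μ) ^ (1 / q) := by
        gcongr with x
        refine (ENNReal.rpow_le_rpow
          (lconvolution_le_of_young_exponents hf hg hp hs hq hpqs x) hq.le).trans_eq ?_
        rw [mul_assoc, ENNReal.mul_rpow_of_nonneg _ _ hq.le, ← ENNReal.rpow_mul,
          one_div_mul_cancel hq.ne', ENNReal.rpow_one]
    _ = (A * B) ^ (1 / q) * (A ^ (1 - 1 / s) * B ^ (1 - 1 / p)) := by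
        rw [lintegral_mul_const'' _ (by fun_prop),
          lintegral_lconvolution (hf.pow_const p) (hg.pow_const s),
          ENNReal.mul_rpow_of_nonneg _ _ hq₁, ← ENNReal.rpow_mul, mul_one_div_cancel hq.ne',
          ENNReal.rpow_one]
    _ = A ^ (1 / p) * B ^ (1 / s) := by
        rw [ENNReal.mul_rpow_of_nonneg _ _ hq₁, mul_mul_mul_comm,
          ← ENNReal.rpow_add_of_nonneg _ _ hq₁ (by linarith),
          ← ENNReal.rpow_add_of_nonneg _ _ hq₁ (by linarith), hpqs]
        congr 2 <;> ring

end Young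

section HomogeneousPowers

open Module

variable {E : Type*} [NormedAddCommGroup E]

theorem enorm_norm_rpow_rpow (x : E) (b : ℝ) {q : ℝ} (hq : 0 ≤ q) :
    ‖‖x‖ ^ b‖ₑ ^ q = ENNReal.ofReal (‖x‖ ^ (b * q)) := by
  rw [Real.enorm_eq_ofReal (by positivity), ENNReal.ofReal_rpow_of_nonneg (by positivity) hq,
    ← Real.rpow_mul (norm_nonneg _)]

variable [MeasurableSpace E] [BorelSpace E] (μ : Measure E)

theorem lintegral_ball_norm_rpow_neg_le {b : ℝ} (hb : 0 ≤ b) (a : E) {r : ℝ} (hr : 0 < r) :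
    ∫⁻ x in ball a r, ENNReal.ofReal (‖x‖ ^ (-b)) ∂μ ≤
      ∫⁻ x in ball 0 r, ENNReal.ofReal (‖x‖ ^ (-b)) ∂μ +
        ENNReal.ofReal (r ^ (-b)) * μ (ball a r) := by
  have hpt : ∀ x : E, ENNReal.ofReal (‖x‖ ^ (-b)) ≤
      (ball 0 r).indicator (fun x => ENNReal.ofReal (‖x‖ ^ (-b))) x +
        ENNReal.ofReal (r ^ (-b)) := by
    intro x
    by_cases hx : x ∈ ball 0 r
    · rw [indicator_of_mem hx]
      exact le_self_add
    · rw [indicator_of_notMem hx, zero_add]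
      exact ENNReal.ofReal_le_ofReal
        (Real.rpow_le_rpow_of_nonpos hr (by simpa using hx) (by linarith))
  refine (lintegral_mono hpt).trans ?_
  rw [lintegral_add_right _ measurable_const, setLIntegral_const]
  exact add_le_add ((setLIntegral_le_lintegral _ _).trans_eq
    (lintegral_indicator measurableSet_ball _)) le_rfl

variable [NormedSpace ℝ E] [FiniteDimensional ℝ E] [μ.IsAddHaarMeasure]

theorem lintegral_ball_zero_norm_rpow (b : ℝ) {r : ℝ} (hr : 0 < r) :
    ∫⁻ x in ball (0 : E) r, ENNReal.ofReal (‖x‖ ^ b) ∂μ =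
      ENNReal.ofReal (r ^ ((finrank ℝ E : ℝ) + b)) *
        ∫⁻ x in ball (0 : E) 1, ENNReal.ofReal (‖x‖ ^ b) ∂μ := by
  have hmeas : Measurable fun x : E => ENNReal.ofReal (‖x‖ ^ b) := by fun_prop
  have hpre : (r • · : E → E) ⁻¹' ball 0 r = ball 0 1 := by
    ext x
    simp [norm_smul, abs_of_pos hr, mul_lt_iff_lt_one_right hr]
  have hhom : ∀ x : E, ENNReal.ofReal (‖r • x‖ ^ b) =
      ENNReal.ofReal (r ^ b) * ENNReal.ofReal (‖x‖ ^ b) := fun x => by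
    rw [norm_smul, Real.norm_of_nonneg hr.le, Real.mul_rpow hr.le (norm_nonneg _),
      ENNReal.ofReal_mul (by positivity)]
  have hscale : ENNReal.ofReal (r ^ finrank ℝ E)⁻¹ *
      ∫⁻ x in ball (0 : E) r, ENNReal.ofReal (‖x‖ ^ b) ∂μ =
      ENNReal.ofReal (r ^ b) * ∫⁻ x in ball (0 : E) 1, ENNReal.ofReal (‖x‖ ^ b) ∂μ := by
    have h := setLIntegral_map (μ := μ) (f := fun x => ENNReal.ofReal (‖x‖ ^ b))
      (measurableSet_ball (x := (0 : E)) (ε := r)) hmeas (measurable_const_smul r)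
    rw [Measure.map_addHaar_smul μ hr.ne', Measure.restrict_smul, lintegral_smul_measure, hpre,
      abs_of_pos (by positivity), smul_eq_mul] at h
    rw [h, ← lintegral_const_mul _ hmeas]
    exact lintegral_congr hhom
  rw [Real.rpow_add hr, ENNReal.ofReal_mul (by positivity), mul_assoc, ← hscale, ← mul_assoc,
    ← ENNReal.ofReal_mul (by positivity), Real.rpow_natCast, mul_inv_cancel₀ (by positivity),
    ENNReal.ofReal_one, one_mul]

theorem exists_lintegral_ball_norm_rpow_neg_le {b : ℝ} (hb : 0 ≤ b) (hbn : b < finrank ℝ E) :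
    ∃ c : ℝ, 0 < c ∧ ∀ (a : E) (r : ℝ), 0 < r →
      ∫⁻ x in ball a r, ENNReal.ofReal (‖x‖ ^ (-b)) ∂μ ≤
        ENNReal.ofReal (c * r ^ ((finrank ℝ E : ℝ) - b)) := by
  have hfin : ∫⁻ x in ball (0 : E) 1, ENNReal.ofReal (‖x‖ ^ (-b)) ∂μ < ∞ :=
    (integrableOn_ball_of_norm_le_rpow (C := 1)
      (Nat.one_le_iff_ne_zero.2 (by rintro h; simp [h] at hbn; linarith)) hbn
      (.of_forall fun x => by rw [Real.norm_of_nonneg (by positivity), one_mul])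
      (by fun_prop : Measurable fun x : E => ‖x‖ ^ (-b)).aestronglyMeasurable).lintegral_lt_top
  have hμ : 0 < μ.real (ball (0 : E) 1) :=
    ENNReal.toReal_pos (measure_ball_pos μ _ one_pos).ne' measure_ball_lt_top.ne
  refine ⟨(∫⁻ x in ball (0 : E) 1, ENNReal.ofReal (‖x‖ ^ (-b)) ∂μ).toReal + μ.real (ball (0 : E) 1),
    by positivity, fun a r hr => (lintegral_ball_norm_rpow_neg_le μ hb a hr).trans_eq ?_⟩
  rw [lintegral_ball_zero_norm_rpow μ _ hr, Measure.addHaar_ball_of_pos μ _ hr,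
    ← ENNReal.ofReal_toReal hfin.ne, ← ofReal_measureReal (measure_ball_lt_top (μ := μ)).ne,
    ← sub_eq_add_neg, ← mul_assoc, ← ENNReal.ofReal_mul (by positivity),
    ← ENNReal.ofReal_mul (by positivity), ← ENNReal.ofReal_mul (by positivity),
    ← ENNReal.ofReal_add (by positivity) (by positivity), ENNReal.toReal_ofReal (by positivity),
    ← Real.rpow_natCast, ← Real.rpow_add hr, neg_add_eq_sub]
  congr 1
  ring

theorem lintegral_compl_ball_norm_rpow_neg_lt_top {b : ℝ} (hb : finrank ℝ E < b) :
    ∫⁻ x in (ball (0 : E) 1)ᶜ, ENNReal.ofReal (‖x‖ ^ (-b)) ∂μ < ∞ := by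
  have : 0 < b := (Nat.cast_nonneg _).trans_lt hb
  calc ∫⁻ x in (ball (0 : E) 1)ᶜ, ENNReal.ofReal (‖x‖ ^ (-b)) ∂μ
      ≤ ∫⁻ x in (ball (0 : E) 1)ᶜ,
          ENNReal.ofReal (2 ^ b) * ENNReal.ofReal ((1 + ‖x‖) ^ (-b)) ∂μ := by
        refine setLIntegral_mono' measurableSet_ball.compl fun x hx => ?_
        have hx₁ : 1 ≤ ‖x‖ := by simpa using hx
        rw [← ENNReal.ofReal_mul (by positivity)]
        refine ENNReal.ofReal_le_ofReal ?_
        calc ‖x‖ ^ (-b) ≤ ((1 + ‖x‖) / 2) ^ (-b) :=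
              Real.rpow_le_rpow_of_nonpos (by positivity) (by linarith) (by linarith)
          _ = 2 ^ b * (1 + ‖x‖) ^ (-b) := by
              rw [Real.div_rpow (by positivity) zero_le_two, Real.rpow_neg zero_le_two,
                div_inv_eq_mul, mul_comm]
    _ ≤ ∫⁻ x, ENNReal.ofReal (2 ^ b) * ENNReal.ofReal ((1 + ‖x‖) ^ (-b)) ∂μ :=
        setLIntegral_le_lintegral _ _
    _ < ∞ := by
        rw [lintegral_const_mul' _ _ ENNReal.ofReal_ne_top]
        exact ENNReal.mul_lt_top ENNReal.ofReal_lt_top (finite_integral_one_add_norm hb)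

end HomogeneousPowers

local notation "𝔼" n:max => EuclideanSpace ℝ (Fin n)

/-- The Lebesgue measure of the unit ball of `ℝⁿ`, as a real number; it converts powers of `|B|`
into powers of the radius of `B`. -/
def unitBallVolume (n : ℕ) : ℝ :=
  volume.real (ball (0 : 𝔼 n) 1)

theorem unitBallVolume_pos (n : ℕ) : 0 < unitBallVolume n :=
  ENNReal.toReal_pos (measure_ball_pos _ _ one_pos).ne' measure_ball_lt_top.ne

variable {n : ℕ}

section MorreyNorms

theorem volume_ball_eq_ofReal (a : 𝔼 n) {r : ℝ} (hr : 0 < r) :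
    volume (ball a r) = ENNReal.ofReal (unitBallVolume n * r ^ (n : ℝ)) := by
  rw [Measure.addHaar_ball_of_pos _ _ hr, unitBallVolume, mul_comm,
    ENNReal.ofReal_mul measureReal_nonneg, ofReal_measureReal measure_ball_lt_top.ne,
    finrank_euclideanSpace_fin, Real.rpow_natCast]

theorem volume_ball_rpow (a : 𝔼 n) {r : ℝ} (hr : 0 < r) (c : ℝ) :
    volume (ball a r) ^ c = ENNReal.ofReal (unitBallVolume n ^ c * r ^ ((n : ℝ) * c)) := by
  have := unitBallVolume_pos n
  rw [volume_ball_eq_ofReal a hr, ENNReal.ofReal_rpow_of_pos (by positivity),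
    Real.mul_rpow this.le (by positivity), ← Real.rpow_mul hr.le]

theorem volume_ball_mul_rpow (a b : 𝔼 n) {k r : ℝ} (hk : 0 < k) (hr : 0 < r) (c : ℝ) :
    volume (ball a (k * r)) ^ c = ENNReal.ofReal (k ^ ((n : ℝ) * c)) * volume (ball b r) ^ c := by
  rw [volume_ball_rpow a (by positivity), volume_ball_rpow b hr,
    ← ENNReal.ofReal_mul (by positivity), Real.mul_rpow hk.le hr.le, mul_left_comm]

theorem volume_ball_rpow_add (a : 𝔼 n) {r : ℝ} (hr : 0 < r) (b c : ℝ) :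
    volume (ball a r) ^ (b + c) = volume (ball a r) ^ b * volume (ball a r) ^ c :=
  ENNReal.rpow_add b c (measure_ball_pos _ _ hr).ne' measure_ball_lt_top.ne

theorem volume_ball_mul_rpow_mul_volume_ball_mul_rpow (a a' a'' : 𝔼 n) {k l r : ℝ} (hk : 0 < k)
    (hl : 0 < l) (hr : 0 < r) (b c : ℝ) :
    volume (ball a (k * r)) ^ b * volume (ball a' (l * r)) ^ c =
      ENNReal.ofReal (k ^ ((n : ℝ) * b) * l ^ ((n : ℝ) * c)) * volume (ball a'' r) ^ (b + c) := by
  rw [volume_ball_mul_rpow a a'' hk hr, volume_ball_mul_rpow a' a'' hl hr, mul_mul_mul_comm,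
    ← ENNReal.ofReal_mul (by positivity), volume_ball_rpow_add a'' hr]

variable {F F' : Type*} [NormedAddCommGroup F] [NormedAddCommGroup F'] {f : 𝔼 n → F}
  {p q t : ℝ} {φ : ℝ → ℝ}

theorem morreyNorm_le_iff {M : ℝ≥0∞} :
    morreyNorm p q f ≤ M ↔ ∀ (a : 𝔼 n) (r : ℝ), 0 < r →
      (∫⁻ x in ball a r, ‖f x‖ₑ ^ p) ^ (1 / p) ≤ volume (ball a r) ^ (1 / p - 1 / q) * M := by
  simp only [morreyNorm, iSup_le_iff]
  refine forall_congr' fun a => forall_congr' fun r => forall_congr' fun hr => ?_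
  have hB₀ : volume (ball a r) ≠ 0 := (measure_ball_pos _ _ hr).ne'
  have hB : volume (ball a r) ≠ ∞ := measure_ball_lt_top.ne
  rw [← neg_sub (1 / p), ENNReal.rpow_neg, ENNReal.inv_mul_le_iff
    (by simp [hB₀, hB]) (by simp [hB₀, hB])]

theorem genMorreyNorm_le_iff (hp : 0 < p) (hφ : ∀ r : ℝ, 0 < r → 0 < φ r) {N : ℝ≥0∞} :
    genMorreyNorm p φ f ≤ N ↔ ∀ (a : 𝔼 n) (r : ℝ), 0 < r →
      (∫⁻ x in ball a r, ‖f x‖ₑ ^ p) ^ (1 / p) ≤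
        volume (ball a r) ^ (1 / p) * (ENNReal.ofReal (φ r) * N) := by
  simp only [genMorreyNorm, iSup_le_iff]
  refine forall_congr' fun a => forall_congr' fun r => forall_congr' fun hr => ?_
  have hB₀ : volume (ball a r) ≠ 0 := (measure_ball_pos _ _ hr).ne'
  have hB : volume (ball a r) ≠ ∞ := measure_ball_lt_top.ne
  rw [ENNReal.inv_mul_le_iff (by simpa using hφ r hr) ENNReal.ofReal_ne_top,
    ENNReal.mul_rpow_of_nonneg _ _ (by positivity), ENNReal.inv_rpow, ENNReal.inv_mul_le_iff
    (by simp [hB₀, hB]) (by simp [hB₀, hB])]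

theorem lintegral_ball_le_genMorreyNorm (hp : 1 ≤ p) (hφ : ∀ r : ℝ, 0 < r → 0 < φ r)
    (hf : AEStronglyMeasurable f volume) (a : 𝔼 n) {r : ℝ} (hr : 0 < r) :
    ∫⁻ x in ball a r, ‖f x‖ₑ ≤
      volume (ball a r) * (ENNReal.ofReal (φ r) * genMorreyNorm p φ f) := by
  have hp₀ : 0 < p := by linarith
  have hp₁ : 0 ≤ 1 - 1 / p := sub_nonneg.2 ((div_le_one hp₀).2 hp)
  have hölder := ENNReal.lintegral_mul_norm_pow_le (μ := volume.restrict (ball a r))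
    (f := fun x => ‖f x‖ₑ ^ p) (g := fun _ => 1) (hf.enorm.restrict.pow_const p) aemeasurable_const
    (p := 1 / p) (q := 1 - 1 / p) (by positivity) hp₁ (by ring)
  simp only [← ENNReal.rpow_mul, mul_one_div_cancel hp₀.ne', ENNReal.rpow_one, ENNReal.one_rpow,
    mul_one, lintegral_const, one_mul, Measure.restrict_apply_univ] at hölder
  calc ∫⁻ x in ball a r, ‖f x‖ₑ
      ≤ (∫⁻ x in ball a r, ‖f x‖ₑ ^ p) ^ (1 / p) * volume (ball a r) ^ (1 - 1 / p) := hölder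
    _ ≤ volume (ball a r) ^ (1 / p) * (ENNReal.ofReal (φ r) * genMorreyNorm p φ f) *
          volume (ball a r) ^ (1 - 1 / p) := by
        gcongr
        exact (genMorreyNorm_le_iff hp₀ hφ).1 le_rfl a r hr
    _ = volume (ball a r) * (ENNReal.ofReal (φ r) * genMorreyNorm p φ f) := by
        rw [mul_right_comm, ← volume_ball_rpow_add a hr, add_sub_cancel, ENNReal.rpow_one]

theorem lintegral_rpow_one_div_const_mul (hp : 0 < p) {α : Type*} [MeasurableSpace α]
    (μ : Measure α) {C : ℝ≥0∞} (hC : C ≠ ∞) (g : α → ℝ≥0∞) :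
    (∫⁻ x, (C * g x) ^ p ∂μ) ^ (1 / p) = C * (∫⁻ x, g x ^ p ∂μ) ^ (1 / p) := by
  simp only [ENNReal.mul_rpow_of_nonneg _ _ hp.le]
  rw [lintegral_const_mul' _ _ (ENNReal.rpow_ne_top_of_nonneg hp.le hC),
    ENNReal.mul_rpow_of_nonneg _ _ (by positivity), ← ENNReal.rpow_mul,
    mul_one_div_cancel hp.ne', ENNReal.rpow_one]

theorem morreyNorm_le_mul (hp : 0 < p) {C : ℝ≥0∞} (hC : C ≠ ∞) {g : 𝔼 n → F'}
    (h : ∀ᵐ x, ‖f x‖ₑ ≤ C * ‖g x‖ₑ) : morreyNorm p q f ≤ C * morreyNorm p q g := by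
  refine morreyNorm_le_iff.2 fun a r hr => ?_
  calc (∫⁻ x in ball a r, ‖f x‖ₑ ^ p) ^ (1 / p)
      ≤ (∫⁻ x in ball a r, (C * ‖g x‖ₑ) ^ p) ^ (1 / p) := by
        refine ENNReal.rpow_le_rpow (lintegral_mono_ae ?_) (by positivity)
        filter_upwards [ae_restrict_of_ae h] with x hx
        exact ENNReal.rpow_le_rpow hx hp.le
    _ = C * (∫⁻ x in ball a r, ‖g x‖ₑ ^ p) ^ (1 / p) :=
        lintegral_rpow_one_div_const_mul hp _ hC _
    _ ≤ volume (ball a r) ^ (1 / p - 1 / q) * (C * morreyNorm p q g) := by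
        rw [mul_left_comm]
        gcongr
        exact morreyNorm_le_iff.1 le_rfl a r hr

theorem exists_morreyNorm_norm_rpow_le [NeZero n] (hq : 0 < q) (hqt : q < t) :
    ∃ c : ℝ, 0 < c ∧
      morreyNorm q t (fun x : 𝔼 n => ‖x‖ ^ (-((n : ℝ) / t))) ≤ ENNReal.ofReal c := by
  have ht : 0 < t := hq.trans hqt
  have hn : (0 : ℝ) < n := mod_cast NeZero.pos n
  obtain ⟨c, hc, hball⟩ := exists_lintegral_ball_norm_rpow_neg_le (volume : Measure (𝔼 n))
    (b := n / t * q) (by positivity) (by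
      rw [finrank_euclideanSpace_fin, div_mul_eq_mul_div, div_lt_iff₀ ht]
      gcongr)
  rw [finrank_euclideanSpace_fin] at hball
  have hω := unitBallVolume_pos n
  refine ⟨(unitBallVolume n ^ (1 / q - 1 / t))⁻¹ * c ^ (1 / q), by positivity,
    morreyNorm_le_iff.2 fun a r hr => ?_⟩
  have hexp : ((n : ℝ) - n / t * q) * (1 / q) = n * (1 / q - 1 / t) := by field_simp
  calc (∫⁻ x in ball a r, ‖‖x‖ ^ (-((n : ℝ) / t))‖ₑ ^ q) ^ (1 / q)
      ≤ ENNReal.ofReal (c * r ^ ((n : ℝ) - n / t * q)) ^ (1 / q) := by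
        simp only [enorm_norm_rpow_rpow _ _ hq.le, neg_mul]
        exact ENNReal.rpow_le_rpow (hball a r hr) (by positivity)
    _ = volume (ball a r) ^ (1 / q - 1 / t) *
          ENNReal.ofReal ((unitBallVolume n ^ (1 / q - 1 / t))⁻¹ * c ^ (1 / q)) := by
        rw [volume_ball_rpow a hr, ENNReal.ofReal_rpow_of_pos (by positivity),
          ← ENNReal.ofReal_mul (by positivity), Real.mul_rpow hc.le (by positivity),
          ← Real.rpow_mul hr.le, hexp]
        congr 1
        field_simp

theorem MemLpLoc.aestronglyMeasurable (hf : MemLpLoc p f) : AEStronglyMeasurable f volume := by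
  rw [← Measure.restrict_univ (μ := volume), ← iUnion_closedBall_nat (0 : 𝔼 n),
    aestronglyMeasurable_iUnion_iff]
  exact fun k => (hf _ (isCompact_closedBall _ _)).1

theorem memGenMorrey_of_genMorreyNorm_lt_top (hp : 0 < p) (hφ : ∀ r : ℝ, 0 < r → 0 < φ r)
    (hf : AEStronglyMeasurable f volume) (hN : genMorreyNorm p φ f < ∞) : MemGenMorrey p φ f := by
  refine ⟨fun A hA => ?_, hN⟩
  obtain ⟨R, hR, hAR⟩ := hA.isBounded.exists_pos_norm_lt
  have hsub : A ⊆ ball 0 R := fun x hx => mem_ball_zero_iff.2 (hAR x hx)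
  refine MemLp.mono_measure (Measure.restrict_mono hsub le_rfl) ⟨hf.restrict, ?_⟩
  rw [eLpNorm_lt_top_iff_lintegral_rpow_enorm_lt_top (by simpa using hp) ENNReal.ofReal_ne_top,
    ENNReal.toReal_ofReal hp.le, ← ENNReal.rpow_lt_top_iff_of_pos (one_div_pos.2 hp)]
  exact ((genMorreyNorm_le_iff hp hφ).1 le_rfl 0 R hR).trans_lt
    (ENNReal.mul_lt_top (ENNReal.rpow_lt_top_of_nonneg (by positivity) measure_ball_lt_top.ne)
      (ENNReal.mul_lt_top ENNReal.ofReal_lt_top hN))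

theorem le_mul_genMorreyNorm_of_ae_le (hp : 0 < p) (hφ : ∀ r : ℝ, 0 < r → 0 < φ r) {a : 𝔼 n}
    {r : ℝ} (hr : 0 < r) {c : ℝ≥0∞} (h : ∀ᵐ x ∂volume.restrict (ball a r), c ≤ ‖f x‖ₑ) :
    c ≤ ENNReal.ofReal (φ r) * genMorreyNorm p φ f := by
  have hB₀ : volume (ball a r) ≠ 0 := (measure_ball_pos _ _ hr).ne'
  have hB : volume (ball a r) ≠ ∞ := measure_ball_lt_top.ne
  have hB₀' : volume (ball a r) ^ (1 / p) ≠ 0 := by simp [hB₀, hB]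
  have hB' : volume (ball a r) ^ (1 / p) ≠ ∞ := by simp [hB₀, hB]
  refine (ENNReal.mul_le_mul_iff_right hB₀' hB').1 ?_
  calc volume (ball a r) ^ (1 / p) * c = (∫⁻ _ in ball a r, c ^ p) ^ (1 / p) := by
        rw [setLIntegral_const, ENNReal.mul_rpow_of_nonneg _ _ (by positivity),
          ← ENNReal.rpow_mul, mul_one_div_cancel hp.ne', ENNReal.rpow_one, mul_comm]
    _ ≤ (∫⁻ x in ball a r, ‖f x‖ₑ ^ p) ^ (1 / p) := by
        refine ENNReal.rpow_le_rpow (lintegral_mono_ae ?_) (by positivity)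
        filter_upwards [h] with x hx
        exact ENNReal.rpow_le_rpow hx hp.le
    _ ≤ _ := (genMorreyNorm_le_iff hp hφ).1 le_rfl a r hr

theorem genMorreyNorm_le_morreyOpNorm_mul {T : (𝔼 n → F) → 𝔼 n → F} {ψ : ℝ → ℝ}
    (hf : MemGenMorrey p φ f) (hf₀ : genMorreyNorm p φ f ≠ 0) :
    genMorreyNorm q ψ (T f) ≤ morreyOpNorm p φ q ψ T * genMorreyNorm p φ f := by
  rw [← ENNReal.div_le_iff hf₀ hf.2.ne]
  exact le_iSup_of_le f (le_iSup_of_le hf (le_iSup_of_le hf₀ le_rfl))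

theorem morreyOpNorm_le {T : (𝔼 n → F) → 𝔼 n → F} {ψ : ℝ → ℝ} {C : ℝ≥0∞}
    (h : ∀ f, MemGenMorrey p φ f → genMorreyNorm q ψ (T f) ≤ C * genMorreyNorm p φ f) :
    morreyOpNorm p φ q ψ T ≤ C := by
  refine iSup_le fun f => iSup_le fun hf => iSup_le fun hf₀ => ?_
  rw [ENNReal.div_le_iff hf₀ hf.2.ne]
  exact h f hf

/-- Radial monotonicity of a kernel: `‖f x‖` decreases as `‖x‖` grows. The origin is exempt, as the
kernels `|x|^{α-n}` take the junk value `0` there. -/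
def RadiallyDecreasing (f : 𝔼 n → F) : Prop :=
  ∀ ⦃x z : 𝔼 n⦄, z ≠ 0 → ‖z‖ ≤ ‖x‖ → ‖f x‖ ≤ ‖f z‖

theorem RadiallyDecreasing.enorm_le_morreyNorm [NeZero n] (hf : RadiallyDecreasing f) (hq : 0 < q)
    {x : 𝔼 n} (hx : x ≠ 0) :
    ‖f x‖ₑ ≤ ENNReal.ofReal (unitBallVolume n ^ (-(1 / t)) * ‖x‖ ^ (-((n : ℝ) / t))) *
      morreyNorm q t f := by
  have hx₀ : 0 < ‖x‖ := norm_pos_iff.2 hx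
  set B := ball (0 : 𝔼 n) ‖x‖
  have hmean : ‖f x‖ₑ ^ q * volume B ≤ ∫⁻ z in B, ‖f z‖ₑ ^ q := by
    rw [← setLIntegral_const]
    refine lintegral_mono_ae ?_
    filter_upwards [ae_restrict_mem measurableSet_ball,
      ae_restrict_of_ae (Measure.ae_ne volume (0 : 𝔼 n))] with z hz hz₀
    exact ENNReal.rpow_le_rpow
      (enorm_le_iff_norm_le.2 (hf hz₀ (mem_ball_zero_iff.1 hz).le)) hq.le
  have hroot : ‖f x‖ₑ * volume B ^ (1 / q) ≤
      volume B ^ (1 / q - 1 / t) * morreyNorm q t f := by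
    refine le_trans ?_ (morreyNorm_le_iff.1 le_rfl 0 ‖x‖ hx₀)
    have h := ENNReal.rpow_le_rpow hmean (one_div_nonneg.2 hq.le)
    rwa [ENNReal.mul_rpow_of_nonneg _ _ (by positivity), ← ENNReal.rpow_mul,
      mul_one_div_cancel hq.ne', ENNReal.rpow_one] at h
  calc ‖f x‖ₑ = ‖f x‖ₑ * volume B ^ (1 / q) * volume B ^ (-(1 / q)) := by
        rw [mul_assoc, ← volume_ball_rpow_add 0 hx₀, add_neg_cancel, ENNReal.rpow_zero, mul_one]
    _ ≤ volume B ^ (1 / q - 1 / t) * morreyNorm q t f * volume B ^ (-(1 / q)) := by gcongr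
    _ = volume B ^ (-(1 / t)) * morreyNorm q t f := by
        rw [mul_right_comm, ← volume_ball_rpow_add 0 hx₀, sub_add_eq_add_sub,
          add_neg_cancel, zero_sub]
    _ = _ := by rw [volume_ball_rpow 0 hx₀, mul_neg, mul_one_div]

end MorreyNorms

section BesselRieszKernel

variable {α γ s t : ℝ}

theorem besselRieszKernel_nonneg (x : 𝔼 n) : 0 ≤ besselRieszKernel α γ x := by
  unfold besselRieszKernel
  positivity

theorem measurable_besselRieszKernel : Measurable (besselRieszKernel α γ : 𝔼 n → ℝ) := by
  unfold besselRieszKernel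
  fun_prop

theorem radiallyDecreasing_besselRieszKernel (hα : α ≤ n) (hγ : 0 ≤ γ) :
    RadiallyDecreasing (besselRieszKernel α γ : 𝔼 n → ℝ) := by
  intro x z hz hzx
  have hz₀ : 0 < ‖z‖ := norm_pos_iff.2 hz
  rw [Real.norm_of_nonneg (besselRieszKernel_nonneg x),
    Real.norm_of_nonneg (besselRieszKernel_nonneg z)]
  have hnum : ‖x‖ ^ (α - n) ≤ ‖z‖ ^ (α - n) :=
    Real.rpow_le_rpow_of_nonpos hz₀ hzx (sub_nonpos.2 hα)
  unfold besselRieszKernel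
  gcongr

theorem besselRieszKernel_le_norm_rpow_neg {b : ℝ} (hγ : 0 ≤ γ) (hb : n - α ≤ b)
    (hb' : b ≤ n + γ - α) {x : 𝔼 n} (hx : x ≠ 0) : besselRieszKernel α γ x ≤ ‖x‖ ^ (-b) := by
  have hx₀ : 0 < ‖x‖ := norm_pos_iff.2 hx
  unfold besselRieszKernel
  rw [div_le_iff₀ (by positivity)]
  rcases le_total ‖x‖ 1 with h | h
  · calc ‖x‖ ^ (α - n) ≤ ‖x‖ ^ (-b) := Real.rpow_le_rpow_of_exponent_ge hx₀ h (by linarith)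
      _ ≤ ‖x‖ ^ (-b) * (1 + ‖x‖) ^ γ :=
          le_mul_of_one_le_right (by positivity) (Real.one_le_rpow (by linarith) hγ)
  · calc ‖x‖ ^ (α - n) ≤ ‖x‖ ^ (-b + γ) := Real.rpow_le_rpow_of_exponent_le h (by linarith)
      _ = ‖x‖ ^ (-b) * ‖x‖ ^ γ := Real.rpow_add hx₀ _ _
      _ ≤ ‖x‖ ^ (-b) * (1 + ‖x‖) ^ γ := by gcongr; linarith

variable [NeZero n]

theorem enorm_besselRieszKernel_ae_le {b : ℝ} (hγ : 0 ≤ γ) (hb : n - α ≤ b)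
    (hb' : b ≤ n + γ - α) :
    ∀ᵐ x : 𝔼 n, ‖besselRieszKernel α γ x‖ₑ ≤ ‖‖x‖ ^ (-b)‖ₑ := by
  filter_upwards [Measure.ae_ne volume (0 : 𝔼 n)] with x hx
  rw [Real.enorm_eq_ofReal (besselRieszKernel_nonneg x), Real.enorm_eq_ofReal (by positivity)]
  exact ENNReal.ofReal_le_ofReal (besselRieszKernel_le_norm_rpow_neg hγ hb hb' hx)

theorem lintegral_besselRieszKernel_rpow_lt_top (hα : α ≤ n) (hγ : 0 ≤ γ) (ht : 0 < t)
    (h₀ : (n - α) * t < n) (h₁ : n < (n + γ - α) * t) :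
    ∫⁻ x : 𝔼 n, ‖besselRieszKernel α γ x‖ₑ ^ t < ∞ := by
  have hpow {b : ℝ} (hb : n - α ≤ b) (hb' : b ≤ n + γ - α) (A : Set (𝔼 n)) :
      ∫⁻ x in A, ‖besselRieszKernel α γ x‖ₑ ^ t ≤
        ∫⁻ x in A, ENNReal.ofReal (‖x‖ ^ (-(b * t))) := by
    refine lintegral_mono_ae ?_
    filter_upwards [ae_restrict_of_ae (enorm_besselRieszKernel_ae_le hγ hb hb')] with x hx
    rw [← neg_mul, ← enorm_norm_rpow_rpow x _ ht.le]
    exact ENNReal.rpow_le_rpow hx ht.le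
  obtain ⟨c, -, hc⟩ := exists_lintegral_ball_norm_rpow_neg_le (volume : Measure (𝔼 n))
    (b := (n - α) * t) (mul_nonneg (by linarith) ht.le) (by simpa using h₀)
  rw [← lintegral_add_compl _ (measurableSet_ball (x := (0 : 𝔼 n)) (ε := 1))]
  refine ENNReal.add_lt_top.2 ⟨?_, ?_⟩
  · exact ((hpow le_rfl (by linarith) _).trans (hc 0 1 one_pos)).trans_lt ENNReal.ofReal_lt_top
  · exact (hpow (b := n + γ - α) (by linarith) le_rfl _).trans_lt
      (lintegral_compl_ball_norm_rpow_neg_lt_top volume (by simpa using h₁))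

theorem morreyNorm_besselRieszKernel_lt_top_of_lt (hγ : 0 ≤ γ) (hs : 0 < s) (hst : s < t)
    (h₀ : (n - α) * t ≤ n) (h₁ : n ≤ (n + γ - α) * t) :
    morreyNorm s t (besselRieszKernel α γ : 𝔼 n → ℝ) < ∞ := by
  have ht : 0 < t := hs.trans hst
  obtain ⟨c, -, hc⟩ := exists_morreyNorm_norm_rpow_le (n := n) hs hst
  have hle : ∀ᵐ x : 𝔼 n, ‖besselRieszKernel α γ x‖ₑ ≤ 1 * ‖‖x‖ ^ (-((n : ℝ) / t))‖ₑ := by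
    simpa only [one_mul] using enorm_besselRieszKernel_ae_le hγ ((le_div_iff₀ ht).2 h₀)
      ((div_le_iff₀ ht).2 h₁)
  exact ((morreyNorm_le_mul hs ENNReal.one_ne_top hle).trans (by rwa [one_mul])).trans_lt
    ENNReal.ofReal_lt_top

theorem morreyNorm_besselRieszKernel_lt_top (hα : α < n) (hγ : 0 ≤ γ) (hs : 0 < s) (hst : s ≤ t)
    (h : (s < t ∧ t = n / (n - α)) ∨ (n / (n + γ - α) < t ∧ t < n / (n - α))) :
    morreyNorm s t (besselRieszKernel α γ : 𝔼 n → ℝ) < ∞ := by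
  have hnα : 0 < (n : ℝ) - α := sub_pos.2 hα
  rcases h with ⟨hlt, ht⟩ | ⟨h₁, h₀⟩
  · have ht' : (n - α) * t = n := by rw [ht, mul_div_cancel₀ _ hnα.ne']
    exact morreyNorm_besselRieszKernel_lt_top_of_lt hγ hs hlt ht'.le
      (by nlinarith [mul_nonneg hγ (hs.trans hlt).le])
  rw [lt_div_iff₀' hnα] at h₀
  rw [div_lt_iff₀' (by linarith)] at h₁
  rcases hst.lt_or_eq with hlt | rfl
  · exact morreyNorm_besselRieszKernel_lt_top_of_lt hγ hs hlt h₀.le h₁.le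
  · refine (morreyNorm_le_iff (M := (∫⁻ x : 𝔼 n, ‖besselRieszKernel α γ x‖ₑ ^ s) ^ (1 / s)).2
      fun a r _ => ?_).trans_lt (ENNReal.rpow_lt_top_of_nonneg (by positivity)
        (lintegral_besselRieszKernel_rpow_lt_top hα.le hγ hs h₀ h₁).ne)
    rw [sub_self, ENNReal.rpow_zero, one_mul]
    exact ENNReal.rpow_le_rpow (setLIntegral_le_lintegral _ _) (by positivity)

end BesselRieszKernel

section ConvolutionSplitting

theorem lintegral_Ioi_rpow_neg {b c : ℝ} (hb : 0 < b) (hc : 0 < c) :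
    ∫⁻ r in Ioi c, ENNReal.ofReal (b * r ^ (-b - 1)) = ENNReal.ofReal (c ^ (-b)) := by
  rw [← ofReal_integral_eq_lintegral_ofReal
    ((integrableOn_Ioi_rpow_of_lt (by linarith) hc).const_mul b), integral_const_mul,
    integral_Ioi_rpow_of_lt (by linarith) hc]
  · congr 1
    rw [sub_add_cancel]
    field_simp
  · filter_upwards [ae_restrict_mem measurableSet_Ioi] with r hr
    have : 0 < r := hc.trans hr
    positivity

theorem lintegral_compl_ball_dist_rpow_neg_mul_le {X : Type*} [PseudoMetricSpace X]
    [MeasurableSpace X] [OpensMeasurableSpace X] {μ : Measure X} [SFinite μ] {b R : ℝ} (hb : 0 < b)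
    (hR : 0 < R) {g : X → ℝ≥0∞} (hg : AEMeasurable g μ) (x : X) :
    ∫⁻ y in (ball x R)ᶜ, ENNReal.ofReal (dist y x ^ (-b)) * g y ∂μ ≤
      ∫⁻ r in Ioi R, ENNReal.ofReal (b * r ^ (-b - 1)) * ∫⁻ y in ball x r, g y ∂μ := by
  have hset : MeasurableSet {z : X × ℝ | dist z.1 x < z.2} :=
    measurableSet_lt ((continuous_id.dist continuous_const).measurable.comp measurable_fst)
      measurable_snd
  set h : X × ℝ → ℝ≥0∞ := {z : X × ℝ | dist z.1 x < z.2}.indicator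
    fun z => ENNReal.ofReal (b * z.2 ^ (-b - 1)) with hh
  have hmeas : Measurable h := Measurable.indicator (by fun_prop) hset
  have hlayer : ∀ y ∈ (ball x R)ᶜ,
      ENNReal.ofReal (dist y x ^ (-b)) * g y = ∫⁻ r in Ioi R, h (y, r) * g y := by
    intro y hy
    have hxy : R ≤ dist y x := by simpa using hy
    have hIoi : (fun r => h (y, r)) =
        (Ioi (dist y x)).indicator fun r => ENNReal.ofReal (b * r ^ (-b - 1)) := by
      ext r
      simp [hh, indicator]
    have hmeas_y : Measurable fun r => h (y, r) := hmeas.comp measurable_prodMk_left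
    rw [lintegral_mul_const _ hmeas_y, hIoi,
      setLIntegral_indicator measurableSet_Ioi, Ioi_inter_Ioi, max_eq_left hxy,
      lintegral_Ioi_rpow_neg hb (hR.trans_le hxy)]
  rw [setLIntegral_congr_fun measurableSet_ball.compl hlayer,
    lintegral_lintegral_swap (hmeas.aemeasurable.mul (hg.restrict.comp_fst))]
  refine lintegral_mono fun r => ?_
  calc ∫⁻ y in (ball x R)ᶜ, h (y, r) * g y ∂μ
      ≤ ∫⁻ y, h (y, r) * g y ∂μ := setLIntegral_le_lintegral _ _
    _ = ∫⁻ y in ball x r, ENNReal.ofReal (b * r ^ (-b - 1)) * g y ∂μ := by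
        rw [← lintegral_indicator measurableSet_ball]
        refine lintegral_congr fun y => ?_
        by_cases hy : dist y x < r <;> simp [hh, indicator, hy]
    _ = ENNReal.ofReal (b * r ^ (-b - 1)) * ∫⁻ y in ball x r, g y ∂μ :=
        lintegral_const_mul' _ _ ENNReal.ofReal_ne_top

theorem lconvolution_le_add_lintegral_compl_ball {E : Type*} [NormedAddCommGroup E]
    [MeasurableSpace E] [OpensMeasurableSpace E] {μ : Measure E} (g k : E → ℝ≥0∞) {a x : E} {R : ℝ}
    (hx : x ∈ ball a R) :
    (g ⋆ₗ[μ] k) x ≤ ((ball a (2 * R)).indicator g ⋆ₗ[μ] (ball 0 (3 * R)).indicator k) x +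
      ∫⁻ y in (ball x R)ᶜ, g y * k (-y + x) ∂μ := by
  have hax : dist x a < R := hx
  rw [lconvolution_def, lconvolution_def, ← lintegral_add_compl _ measurableSet_ball]
  refine add_le_add ?_ (lintegral_mono_set (compl_subset_compl.2
    (ball_subset_ball' (by linarith) : ball x R ⊆ ball a (2 * R))))
  rw [← lintegral_indicator measurableSet_ball]
  refine lintegral_mono fun y => ?_
  by_cases hy : y ∈ ball a (2 * R)
  · have hyx : -y + x ∈ ball 0 (3 * R) := by
      rw [mem_ball_zero_iff, neg_add_eq_sub, ← dist_eq_norm]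
      linarith [dist_triangle_right x y a, mem_ball.1 hy]
    simp only [indicator_of_mem hy, indicator_of_mem hyx, le_refl]
  · simp only [indicator_of_notMem hy, zero_le]

theorem lintegral_indicator_rpow {X : Type*} [MeasurableSpace X] {μ : Measure X} {A : Set X}
    (hA : MeasurableSet A) (g : X → ℝ≥0∞) {p : ℝ} (hp : 0 < p) :
    ∫⁻ x, A.indicator g x ^ p ∂μ = ∫⁻ x in A, g x ^ p ∂μ := by
  rw [← lintegral_indicator hA]
  refine lintegral_congr fun x => ?_
  by_cases hx : x ∈ A <;> simp [hx, hp]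

end ConvolutionSplitting

section UpperBound

/-- The tail condition `∫_R^∞ φ(r) r^{β-1} dr ≤ C φ(R) R^β` for all `R > 0`, which is hypothesis (i)
with `β = n - n/t`. -/
def HasDominatedTail (β : ℝ) (φ : ℝ → ℝ) : Prop :=
  ∃ C : ℝ, 0 < C ∧ ∀ R : ℝ, 0 < R →
    ∫⁻ r in Ioi R, ENNReal.ofReal (φ r * r ^ (β - 1)) ≤ ENNReal.ofReal (C * (φ R * R ^ β))

variable {F F' : Type*} [NormedAddCommGroup F] [NormedAddCommGroup F'] {p s t : ℝ} {φ : ℝ → ℝ}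

theorem HasDominatedTail.exists_lintegral_compl_ball_le {b : ℝ} (h : HasDominatedTail (n - b) φ)
    (hb : 0 < b) (hp : 1 ≤ p) (hφ : ∀ r : ℝ, 0 < r → 0 < φ r) :
    ∃ C : ℝ, 0 < C ∧ ∀ f : 𝔼 n → F, AEStronglyMeasurable f volume → genMorreyNorm p φ f ≠ ∞ →
      ∀ (x : 𝔼 n) (R : ℝ), 0 < R →
        ∫⁻ y in (ball x R)ᶜ, ENNReal.ofReal (dist y x ^ (-b)) * ‖f y‖ₑ ≤
          ENNReal.ofReal (C * (φ R * R ^ (n - b))) * genMorreyNorm p φ f := by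
  obtain ⟨C₁, hC₁, htail⟩ := h
  have hω := unitBallVolume_pos n
  refine ⟨b * unitBallVolume n * C₁, by positivity, fun f hf hN x R hR => ?_⟩
  calc ∫⁻ y in (ball x R)ᶜ, ENNReal.ofReal (dist y x ^ (-b)) * ‖f y‖ₑ
      ≤ ∫⁻ r in Ioi R, ENNReal.ofReal (b * r ^ (-b - 1)) * ∫⁻ y in ball x r, ‖f y‖ₑ :=
        lintegral_compl_ball_dist_rpow_neg_mul_le hb hR hf.enorm x
    _ ≤ ∫⁻ r in Ioi R, ENNReal.ofReal (b * unitBallVolume n) *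
          ENNReal.ofReal (φ r * r ^ (n - b - 1)) * genMorreyNorm p φ f := by
        refine setLIntegral_mono' measurableSet_Ioi fun r hr => ?_
        have hr₀ : 0 < r := hR.trans hr
        have := hφ r hr₀
        refine (mul_le_mul_right (lintegral_ball_le_genMorreyNorm hp hφ hf x hr₀) _).trans_eq ?_
        rw [volume_ball_eq_ofReal x hr₀, ← mul_assoc, ← mul_assoc,
          ← ENNReal.ofReal_mul (by positivity), ← ENNReal.ofReal_mul (by positivity),
          ← ENNReal.ofReal_mul (by positivity),
          show (n : ℝ) - b - 1 = -b - 1 + n by ring, Real.rpow_add hr₀]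
        congr 2
        ring
    _ = ENNReal.ofReal (b * unitBallVolume n) *
          (∫⁻ r in Ioi R, ENNReal.ofReal (φ r * r ^ (n - b - 1))) * genMorreyNorm p φ f := by
        rw [lintegral_mul_const' _ _ hN, lintegral_const_mul' _ _ ENNReal.ofReal_ne_top]
    _ ≤ _ := by
        rw [mul_assoc _ C₁, ENNReal.ofReal_mul (by positivity : 0 ≤ b * unitBallVolume n)]
        gcongr
        exact htail R hR

theorem HasDominatedTail.exists_lintegral_compl_ball_kernel_le [NeZero n] (hs : 0 < s) (ht : 0 < t)
    (h : HasDominatedTail (n - n / t) φ) (hp : 1 ≤ p) (hφ : ∀ r : ℝ, 0 < r → 0 < φ r) :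
    ∃ C : ℝ, 0 < C ∧ ∀ (K : 𝔼 n → F') (f : 𝔼 n → F), RadiallyDecreasing K →
      morreyNorm s t K ≠ ∞ → AEStronglyMeasurable f volume → genMorreyNorm p φ f ≠ ∞ →
      ∀ (x : 𝔼 n) (R : ℝ), 0 < R → ∫⁻ y in (ball x R)ᶜ, ‖f y‖ₑ * ‖K (-y + x)‖ₑ ≤
        ENNReal.ofReal (C * (φ R * R ^ (n - n / t))) *
          (morreyNorm s t K * genMorreyNorm p φ f) := by
  have hn : (0 : ℝ) < n := mod_cast NeZero.pos n
  obtain ⟨C, hC, hfar⟩ := h.exists_lintegral_compl_ball_le (F := F) (by positivity) hp hφ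
  have hω := unitBallVolume_pos n
  refine ⟨unitBallVolume n ^ (-(1 / t)) * C, by positivity, fun K f hK hM hf hN x R hR => ?_⟩
  set c := ENNReal.ofReal (unitBallVolume n ^ (-(1 / t))) * morreyNorm s t K
  have hdecay : ∀ y ∈ (ball x R)ᶜ, ‖f y‖ₑ * ‖K (-y + x)‖ₑ ≤
      c * (ENNReal.ofReal (dist y x ^ (-((n : ℝ) / t))) * ‖f y‖ₑ) := by
    intro y hy
    have hyx : -y + x ≠ 0 := fun h₀ => hy (by
      rw [← neg_add_eq_zero.1 h₀]
      exact mem_ball_self hR)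
    refine (mul_le_mul_right (hK.enorm_le_morreyNorm (t := t) hs hyx) _).trans_eq ?_
    rw [ENNReal.ofReal_mul (by positivity), neg_add_eq_sub, ← dist_eq_norm, dist_comm]
    ring
  calc ∫⁻ y in (ball x R)ᶜ, ‖f y‖ₑ * ‖K (-y + x)‖ₑ
      ≤ ∫⁻ y in (ball x R)ᶜ, c * (ENNReal.ofReal (dist y x ^ (-((n : ℝ) / t))) * ‖f y‖ₑ) :=
        setLIntegral_mono' measurableSet_ball.compl hdecay
    _ = c * ∫⁻ y in (ball x R)ᶜ, ENNReal.ofReal (dist y x ^ (-((n : ℝ) / t))) * ‖f y‖ₑ :=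
        lintegral_const_mul' _ _ (ENNReal.mul_ne_top ENNReal.ofReal_ne_top hM)
    _ ≤ c * (ENNReal.ofReal (C * (φ R * R ^ (n - n / t))) * genMorreyNorm p φ f) := by
        gcongr
        exact hfar f hf hN x R hR
    _ = _ := by
        rw [mul_assoc _ C, ENNReal.ofReal_mul (by positivity :
          0 ≤ unitBallVolume n ^ (-(1 / t)))]
        ring

theorem lintegral_lconvolution_indicator_ball_le {q : ℝ} (hp : 1 ≤ p) (hs : 1 ≤ s) (hq : 0 < q)
    (hpqs : 1 / q = 1 / p + 1 / s - 1) (hφ : ∀ r : ℝ, 0 < r → 0 < φ r) {f : 𝔼 n → F}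
    {K : 𝔼 n → F'} (hf : AEStronglyMeasurable f volume) (hK : AEStronglyMeasurable K volume)
    (a b : 𝔼 n) {r ρ : ℝ} (hr : 0 < r) (hρ : 0 < ρ) :
    (∫⁻ x, ((ball a r).indicator (‖f ·‖ₑ) ⋆ₗ[volume] (ball b ρ).indicator (‖K ·‖ₑ)) x ^ q) ^
        (1 / q) ≤
      volume (ball a r) ^ (1 / p) * (ENNReal.ofReal (φ r) * genMorreyNorm p φ f) *
        (volume (ball b ρ) ^ (1 / s - 1 / t) * morreyNorm s t K) := by
  have hp₀ : 0 < p := by linarith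
  refine (lintegral_lconvolution_rpow_le (hf.enorm.indicator measurableSet_ball)
    (hK.enorm.indicator measurableSet_ball) hp hs hq hpqs).trans ?_
  rw [lintegral_indicator_rpow measurableSet_ball _ hp₀,
    lintegral_indicator_rpow measurableSet_ball _ (by linarith)]
  exact mul_le_mul' ((genMorreyNorm_le_iff hp₀ hφ).1 le_rfl a r hr)
    (morreyNorm_le_iff.1 le_rfl b ρ hρ)

theorem exists_lintegral_lconvolution_indicator_ball_le (hp : 1 ≤ p) (hs : 1 ≤ s)
    (hφ : ∀ r : ℝ, 0 < r → 0 < φ r) (hdec : AlmostDecreasing φ) :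
    ∃ C : ℝ, 0 < C ∧ ∀ q : ℝ, 0 < q → 1 / q = 1 / p + 1 / s - 1 →
      ∀ (K : 𝔼 n → F') (f : 𝔼 n → F), AEStronglyMeasurable K volume →
      AEStronglyMeasurable f volume → ∀ (a : 𝔼 n) (R : ℝ), 0 < R →
        (∫⁻ x, ((ball a (2 * R)).indicator (‖f ·‖ₑ) ⋆ₗ[volume]
          (ball 0 (3 * R)).indicator (‖K ·‖ₑ)) x ^ q) ^ (1 / q) ≤
        volume (ball a R) ^ (1 / q) * (ENNReal.ofReal (C * (φ R * R ^ ((n : ℝ) - n / t))) *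
          (morreyNorm s t K * genMorreyNorm p φ f)) := by
  obtain ⟨c, hc, hdec⟩ := hdec
  have hω := unitBallVolume_pos n
  set A : ℝ := 2 ^ ((n : ℝ) * (1 / p)) * 3 ^ ((n : ℝ) * (1 / s - 1 / t))
  have : 0 < A := by positivity
  refine ⟨A * unitBallVolume n ^ (1 - 1 / t) * c⁻¹, by positivity,
    fun q hq hpqs K f hK hf a R hR => ?_⟩
  have := hφ R hR
  have hφ₂ : φ (2 * R) ≤ c⁻¹ * φ R := by
    rw [← div_eq_inv_mul, le_div_iff₀' hc]
    exact hdec R (2 * R) hR (by linarith)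
  have hvol : volume (ball a (2 * R)) ^ (1 / p) *
      volume (ball (0 : 𝔼 n) (3 * R)) ^ (1 / s - 1 / t) =
      ENNReal.ofReal A * (volume (ball a R) ^ (1 / q) *
        ENNReal.ofReal (unitBallVolume n ^ (1 - 1 / t) * R ^ ((n : ℝ) - n / t))) := by
    rw [volume_ball_mul_rpow_mul_volume_ball_mul_rpow a 0 a two_pos three_pos hR,
      show 1 / p + (1 / s - 1 / t) = 1 / q + (1 - 1 / t) by rw [hpqs]; ring,
      volume_ball_rpow_add a hR, volume_ball_rpow a hR (1 - 1 / t),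
      show (n : ℝ) * (1 - 1 / t) = n - n / t by ring]
  have hconst : ENNReal.ofReal (A * unitBallVolume n ^ (1 - 1 / t) * c⁻¹ *
      (φ R * R ^ ((n : ℝ) - n / t))) = ENNReal.ofReal A *
        ENNReal.ofReal (unitBallVolume n ^ (1 - 1 / t) * R ^ ((n : ℝ) - n / t)) *
        ENNReal.ofReal (c⁻¹ * φ R) := by
    rw [← ENNReal.ofReal_mul (by positivity), ← ENNReal.ofReal_mul (by positivity)]
    congr 1
    ring
  calc _ ≤ volume (ball a (2 * R)) ^ (1 / p) *
          (ENNReal.ofReal (φ (2 * R)) * genMorreyNorm p φ f) *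
        (volume (ball (0 : 𝔼 n) (3 * R)) ^ (1 / s - 1 / t) * morreyNorm s t K) :=
        lintegral_lconvolution_indicator_ball_le hp hs hq hpqs hφ hf hK a 0 (by positivity)
          (by positivity)
    _ ≤ volume (ball a (2 * R)) ^ (1 / p) *
          (ENNReal.ofReal (c⁻¹ * φ R) * genMorreyNorm p φ f) *
        (volume (ball (0 : 𝔼 n) (3 * R)) ^ (1 / s - 1 / t) * morreyNorm s t K) := by gcongr
    _ = _ := by
        rw [mul_mul_mul_comm, hvol, hconst]
        ring

theorem exists_lintegral_ball_lconvolution_le [NeZero n] (hp : 1 ≤ p) (hs : 1 ≤ s) (ht : 0 < t)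
    (hφ : ∀ r : ℝ, 0 < r → 0 < φ r) (hdec : AlmostDecreasing φ)
    (h : HasDominatedTail (n - n / t) φ) :
    ∃ C : ℝ, 0 < C ∧ ∀ q : ℝ, 1 ≤ q → 1 / q = 1 / p + 1 / s - 1 →
      ∀ (K : 𝔼 n → F') (f : 𝔼 n → F), AEStronglyMeasurable K volume → RadiallyDecreasing K →
      morreyNorm s t K ≠ ∞ → AEStronglyMeasurable f volume → genMorreyNorm p φ f ≠ ∞ →
      ∀ (a : 𝔼 n) (R : ℝ), 0 < R →
        (∫⁻ x in ball a R, ((‖f ·‖ₑ) ⋆ₗ[volume] (‖K ·‖ₑ)) x ^ q) ^ (1 / q) ≤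
        volume (ball a R) ^ (1 / q) * (ENNReal.ofReal (C * (φ R * R ^ ((n : ℝ) - n / t))) *
          (morreyNorm s t K * genMorreyNorm p φ f)) := by
  obtain ⟨A, hA, hnear⟩ := exists_lintegral_lconvolution_indicator_ball_le (n := n) (F := F)
    (F' := F') (t := t) hp hs hφ hdec
  obtain ⟨B, hB, hfar⟩ := h.exists_lintegral_compl_ball_kernel_le (F := F) (F' := F') (s := s)
    (by linarith) ht hp hφ
  refine ⟨A + B, by positivity, fun q hq hpqs K f hKm hK hM hf hN a R hR => ?_⟩
  have hq₀ : 0 < q := by linarith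
  have hφR := hφ R hR
  set P := morreyNorm s t K * genMorreyNorm p φ f
  set D := ENNReal.ofReal (B * (φ R * R ^ ((n : ℝ) - n / t))) * P
  set G := (ball a (2 * R)).indicator (‖f ·‖ₑ) ⋆ₗ[volume] (ball 0 (3 * R)).indicator (‖K ·‖ₑ)
  have hG : AEMeasurable G volume := aemeasurable_lconvolution
    (hf.enorm.indicator measurableSet_ball) (hKm.enorm.indicator measurableSet_ball)
  calc (∫⁻ x in ball a R, ((‖f ·‖ₑ) ⋆ₗ[volume] (‖K ·‖ₑ)) x ^ q) ^ (1 / q)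
      ≤ (∫⁻ x in ball a R, (G x + D) ^ q) ^ (1 / q) := by
        refine ENNReal.rpow_le_rpow (setLIntegral_mono' measurableSet_ball fun x hx => ?_)
          (by positivity)
        refine ENNReal.rpow_le_rpow ?_ hq₀.le
        exact (lconvolution_le_add_lintegral_compl_ball _ _ hx).trans
          (add_le_add_right (hfar K f hK hM hf hN x R hR) _)
    _ ≤ (∫⁻ x in ball a R, G x ^ q) ^ (1 / q) + (∫⁻ _ in ball a R, D ^ q) ^ (1 / q) :=
        ENNReal.lintegral_Lp_add_le hG.restrict aemeasurable_const hq
    _ ≤ volume (ball a R) ^ (1 / q) * (ENNReal.ofReal (A * (φ R * R ^ ((n : ℝ) - n / t))) * P) +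
        volume (ball a R) ^ (1 / q) * D := by
        refine add_le_add ((ENNReal.rpow_le_rpow (setLIntegral_le_lintegral _ _)
          (by positivity)).trans (hnear q hq₀ hpqs K f hKm hf a R hR)) ?_
        rw [setLIntegral_const, ENNReal.mul_rpow_of_nonneg _ _ (by positivity),
          ← ENNReal.rpow_mul, mul_one_div_cancel hq₀.ne', ENNReal.rpow_one, mul_comm]
    _ = _ := by
        rw [← mul_add, ← add_mul, ← ENNReal.ofReal_add (by positivity) (by positivity), add_mul]

end UpperBound

section KernelOperator

variable {𝕜 : Type*} [RCLike 𝕜] {K : 𝔼 n → ℝ} {f : 𝔼 n → 𝕜} {p q s t : ℝ} {φ : ℝ → ℝ}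

/-- The convolution operator `f ↦ K * f` with a real kernel; `besselRiesz α γ` is the case
`K = besselRieszKernel α γ`. -/
def kernelOperator (K : 𝔼 n → ℝ) (f : 𝔼 n → 𝕜) : 𝔼 n → 𝕜 :=
  fun x => ∫ y, K (x - y) • f y

theorem lintegral_enorm_kernel_smul (K : 𝔼 n → ℝ) (f : 𝔼 n → 𝕜) (x : 𝔼 n) :
    ∫⁻ y, ‖K (x - y) • f y‖ₑ = ((‖f ·‖ₑ) ⋆ₗ[volume] (‖K ·‖ₑ)) x := by
  rw [lconvolution_def]
  exact lintegral_congr fun y => by rw [enorm_smul, mul_comm, neg_add_eq_sub]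

theorem enorm_kernelOperator_le (K : 𝔼 n → ℝ) (f : 𝔼 n → 𝕜) (x : 𝔼 n) :
    ‖kernelOperator K f x‖ₑ ≤ ((‖f ·‖ₑ) ⋆ₗ[volume] (‖K ·‖ₑ)) x :=
  (enorm_integral_le_lintegral_enorm _).trans_eq (lintegral_enorm_kernel_smul K f x)

theorem aestronglyMeasurable_kernelOperator (hK : Measurable K)
    (hf : AEStronglyMeasurable f volume) : AEStronglyMeasurable (kernelOperator K f) volume :=
  AEStronglyMeasurable.integral_prod_right' (f := fun z : 𝔼 n × 𝔼 n => K (z.1 - z.2) • f z.2)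
    ((hK.comp (measurable_fst.sub measurable_snd)).aestronglyMeasurable.smul hf.comp_snd)

theorem ae_lt_top_of_lintegral_ball_rpow_ne_top {g : 𝔼 n → ℝ≥0∞} (hg : AEMeasurable g volume)
    (hq : 0 < q) (h : ∀ R : ℝ, 0 < R → ∫⁻ x in ball (0 : 𝔼 n) R, g x ^ q ≠ ∞) :
    ∀ᵐ x, g x < ∞ := by
  rw [← Measure.restrict_univ (μ := (volume : Measure (𝔼 n))), ← iUnion_ball_nat_succ (0 : 𝔼 n),
    ae_restrict_iUnion_iff]
  intro k
  filter_upwards [ae_lt_top' (hg.restrict.pow_const q) (h (k + 1) (by positivity))] with x hx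
  exact (ENNReal.rpow_lt_top_iff_of_pos hq).1 hx

theorem exists_kernelOperator_bounded (𝕜 : Type*) [RCLike 𝕜] [NeZero n] (hp : 1 ≤ p) (hs : 1 ≤ s)
    (ht : 0 < t) (hφ : ∀ r : ℝ, 0 < r → 0 < φ r) (hdec : AlmostDecreasing φ)
    (h : HasDominatedTail (n - n / t) φ) :
    ∃ C : ℝ, 0 < C ∧ ∀ q : ℝ, 1 ≤ q → 1 / q = 1 / p + 1 / s - 1 →
      ∀ ψ : ℝ → ℝ, (∀ r : ℝ, 0 < r → ψ r = φ r * r ^ ((n : ℝ) - n / t)) →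
      ∀ K : 𝔼 n → ℝ, Measurable K → RadiallyDecreasing K → morreyNorm s t K < ∞ →
      ∀ f : 𝔼 n → 𝕜, MemGenMorrey p φ f →
        (∀ᵐ x, Integrable fun y => K (x - y) • f y) ∧ MemGenMorrey q ψ (kernelOperator K f) ∧
        genMorreyNorm q ψ (kernelOperator K f) ≤
          ENNReal.ofReal C * morreyNorm s t K * genMorreyNorm p φ f := by
  obtain ⟨C, hC, hball⟩ := exists_lintegral_ball_lconvolution_le (F := 𝕜) (F' := ℝ) hp hs ht hφ
    hdec h
  refine ⟨C, hC, fun q hq hpqs ψ hψ K hKm hK hM f hf => ?_⟩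
  have hq₀ : 0 < q := by linarith
  have hψ₀ : ∀ r : ℝ, 0 < r → 0 < ψ r := fun r hr => by
    have := hφ r hr
    rw [hψ r hr]
    positivity
  have hfm := hf.1.aestronglyMeasurable
  have hconv := hball q hq hpqs K f hKm.aestronglyMeasurable hK hM.ne hfm hf.2.ne
  have hfin : ∀ᵐ x, ((‖f ·‖ₑ) ⋆ₗ[volume] (‖K ·‖ₑ)) x < ∞ := by
    refine ae_lt_top_of_lintegral_ball_rpow_ne_top
      (aemeasurable_lconvolution hfm.enorm hKm.enorm.aemeasurable) hq₀ fun R hR => ?_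
    rw [← lt_top_iff_ne_top, ← ENNReal.rpow_lt_top_iff_of_pos (one_div_pos.2 hq₀)]
    exact (hconv 0 R hR).trans_lt (ENNReal.mul_lt_top
      (ENNReal.rpow_lt_top_of_nonneg (by positivity) measure_ball_lt_top.ne)
      (ENNReal.mul_lt_top ENNReal.ofReal_lt_top (ENNReal.mul_lt_top hM hf.2)))
  have hbound : genMorreyNorm q ψ (kernelOperator K f) ≤
      ENNReal.ofReal C * morreyNorm s t K * genMorreyNorm p φ f := by
    refine (genMorreyNorm_le_iff hq₀ hψ₀).2 fun a R hR => ?_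
    calc (∫⁻ x in ball a R, ‖kernelOperator K f x‖ₑ ^ q) ^ (1 / q)
        ≤ (∫⁻ x in ball a R, ((‖f ·‖ₑ) ⋆ₗ[volume] (‖K ·‖ₑ)) x ^ q) ^ (1 / q) := by
          gcongr with x
          exact enorm_kernelOperator_le K f x
      _ ≤ _ := hconv a R hR
      _ = _ := by
          rw [← hψ R hR, ENNReal.ofReal_mul hC.le]
          ring
  refine ⟨?_, memGenMorrey_of_genMorreyNorm_lt_top hq₀ hψ₀
    (aestronglyMeasurable_kernelOperator hKm hfm) (hbound.trans_lt
      (ENNReal.mul_lt_top (ENNReal.mul_lt_top ENNReal.ofReal_lt_top hM) hf.2)), hbound⟩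
  filter_upwards [hfin] with x hx
  refine ⟨(hKm.comp (measurable_const.sub measurable_id)).aestronglyMeasurable.smul hfm, ?_⟩
  rwa [hasFiniteIntegral_iff_enorm, lintegral_enorm_kernel_smul]

end KernelOperator

section LowerBound

variable {F 𝕜 : Type*} [NormedAddCommGroup F] [RCLike 𝕜] {p t : ℝ} {φ : ℝ → ℝ}

theorem AlmostIncreasing.rpow {g : ℝ → ℝ} (hg : AlmostIncreasing g)
    (hg₀ : ∀ r : ℝ, 0 < r → 0 ≤ g r) {c : ℝ} (hc : 0 ≤ c) : AlmostIncreasing fun r => g r ^ c := by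
  obtain ⟨C, hC, hg⟩ := hg
  refine ⟨C ^ c, by positivity, fun r s hr hrs => ?_⟩
  rw [← Real.mul_rpow hC.le (hg₀ s (hr.trans_le hrs))]
  exact Real.rpow_le_rpow (hg₀ r hr) (hg r s hr hrs) hc

theorem IsClassG.almostIncreasing_mul_rpow (hp : 0 < p) (hφ : IsClassG n p φ) :
    AlmostIncreasing fun r => φ r * r ^ ((n : ℝ) * (1 / p)) := by
  have hroot : ∀ r : ℝ, 0 < r → (φ r ^ p * r ^ (n : ℝ)) ^ (1 / p) =
      φ r * r ^ ((n : ℝ) * (1 / p)) := fun r hr => by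
    have hφr := hφ.pos r hr
    rw [Real.mul_rpow (by positivity) (by positivity), ← Real.rpow_mul hφr.le,
      mul_one_div_cancel hp.ne', Real.rpow_one, ← Real.rpow_mul hr.le]
  obtain ⟨C, hC, h⟩ := hφ.almostIncreasing.rpow (c := 1 / p)
    (fun r hr => by have := hφ.pos r hr; positivity) (by positivity)
  refine ⟨C, hC, fun r s hr hrs => ?_⟩
  simpa only [hroot r hr, hroot s (hr.trans_le hrs)] using h r s hr hrs

theorem IsClassG.exists_mul_min_rpow_le (hp : 0 < p) (hφ : IsClassG n p φ) :
    ∃ C : ℝ, 0 < C ∧ ∀ r R : ℝ, 0 < r → 0 < R →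
      φ R * min r R ^ ((n : ℝ) * (1 / p)) ≤ C * (φ r * r ^ ((n : ℝ) * (1 / p))) := by
  obtain ⟨c, hc, hdec⟩ := hφ.almostDecreasing
  obtain ⟨D, -, hinc⟩ := hφ.almostIncreasing_mul_rpow hp
  refine ⟨max c⁻¹ D, by positivity, fun r R hr hR => ?_⟩
  have hφr := hφ.pos r hr
  rcases le_total r R with hrR | hRr
  · have hφR : φ R ≤ c⁻¹ * φ r := by
      rw [← div_eq_inv_mul, le_div_iff₀' hc]
      exact hdec r R hr hrR
    calc φ R * min r R ^ ((n : ℝ) * (1 / p)) ≤ c⁻¹ * φ r * r ^ ((n : ℝ) * (1 / p)) := by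
          rw [min_eq_left hrR]
          gcongr
      _ ≤ max c⁻¹ D * (φ r * r ^ ((n : ℝ) * (1 / p))) := by
          rw [mul_assoc]
          gcongr
          exact le_max_left _ _
  · rw [min_eq_right hRr]
    refine (hinc R r hR hRr).trans ?_
    gcongr
    exact le_max_right _ _

theorem lintegral_ball_enorm_indicator_one_rpow (hp : 0 < p) (a b : 𝔼 n) (r R : ℝ) :
    ∫⁻ x in ball a r, ‖(ball b R).indicator (fun _ => (1 : 𝕜)) x‖ₑ ^ p =
      volume (ball b R ∩ ball a r) := by
  simp only [enorm_indicator_eq_indicator_enorm, enorm_one]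
  rw [lintegral_indicator_rpow measurableSet_ball _ hp]
  simp only [ENNReal.one_rpow, setLIntegral_one, Measure.restrict_apply measurableSet_ball]

theorem exists_genMorreyNorm_indicator_ball_le (𝕜 : Type*) [RCLike 𝕜] (hp : 0 < p)
    (hφ : IsClassG n p φ) :
    ∃ C : ℝ, 0 < C ∧ ∀ (b : 𝔼 n) (R : ℝ), 0 < R →
      genMorreyNorm p φ ((ball b R).indicator fun _ => (1 : 𝕜)) ≤ ENNReal.ofReal (C / φ R) := by
  obtain ⟨C, hC, hmin⟩ := hφ.exists_mul_min_rpow_le hp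
  have hω := unitBallVolume_pos n
  refine ⟨C, hC, fun b R hR => (genMorreyNorm_le_iff hp hφ.pos).2 fun a r hr => ?_⟩
  have hφR := hφ.pos R hR
  have hφr := hφ.pos r hr
  have hinter : volume (ball b R ∩ ball a r) ≤ volume (ball a (min r R)) := by
    rcases min_choice r R with h | h
    · rw [h]
      exact measure_mono inter_subset_right
    · rw [h, Measure.addHaar_ball_center volume a, ← Measure.addHaar_ball_center volume b]
      exact measure_mono inter_subset_left
  rw [lintegral_ball_enorm_indicator_one_rpow hp, ← ENNReal.ofReal_mul hφr.le]
  calc volume (ball b R ∩ ball a r) ^ (1 / p) ≤ volume (ball a (min r R)) ^ (1 / p) := by gcongr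
    _ = ENNReal.ofReal (unitBallVolume n ^ (1 / p) * min r R ^ ((n : ℝ) * (1 / p))) :=
        volume_ball_rpow a (lt_min hr hR) _
    _ ≤ ENNReal.ofReal (unitBallVolume n ^ (1 / p) * r ^ ((n : ℝ) * (1 / p)) *
          (φ r * (C / φ R))) := by
        have hle : min r R ^ ((n : ℝ) * (1 / p)) ≤
            r ^ ((n : ℝ) * (1 / p)) * (φ r * (C / φ R)) := by
          rw [show r ^ ((n : ℝ) * (1 / p)) * (φ r * (C / φ R)) =
            C * (φ r * r ^ ((n : ℝ) * (1 / p))) / φ R by ring, le_div_iff₀' hφR]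
          exact hmin r R hr hR
        rw [mul_assoc]
        gcongr
    _ = _ := by rw [volume_ball_rpow a hr, ENNReal.ofReal_mul (by positivity)]

theorem genMorreyNorm_indicator_ball_ne_zero (𝕜 : Type*) [RCLike 𝕜] (hp : 0 < p)
    (hφ : ∀ r : ℝ, 0 < r → 0 < φ r) (b : 𝔼 n) {R : ℝ} (hR : 0 < R) :
    genMorreyNorm p φ ((ball b R).indicator fun _ => (1 : 𝕜)) ≠ 0 := by
  intro h₀
  have h : (1 : ℝ≥0∞) ≤ ENNReal.ofReal (φ R) *
      genMorreyNorm p φ ((ball b R).indicator fun _ => (1 : 𝕜)) := by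
    refine le_mul_genMorreyNorm_of_ae_le (a := b) hp hφ hR ?_
    filter_upwards [ae_restrict_mem measurableSet_ball] with x hx
    simp [indicator_of_mem hx]
  simp [h₀] at h

theorem memGenMorrey_indicator_ball (𝕜 : Type*) [RCLike 𝕜] (hp : 0 < p) (hφ : IsClassG n p φ)
    (b : 𝔼 n) {R : ℝ} (hR : 0 < R) :
    MemGenMorrey p φ ((ball b R).indicator fun _ => (1 : 𝕜)) := by
  obtain ⟨C, -, hC⟩ := exists_genMorreyNorm_indicator_ball_le 𝕜 hp hφ
  exact memGenMorrey_of_genMorreyNorm_lt_top hp hφ.pos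
    (aestronglyMeasurable_const.indicator measurableSet_ball)
    ((hC b R hR).trans_lt ENNReal.ofReal_lt_top)

theorem enorm_kernelOperator_indicator_one {K : 𝔼 n → ℝ} (hK : ∀ x, 0 ≤ K x) {S : Set (𝔼 n)}
    (hS : MeasurableSet S) {x : 𝔼 n}
    (hx : Integrable fun y => K (x - y) • S.indicator (fun _ => (1 : 𝕜)) y) :
    ‖kernelOperator K (S.indicator fun _ => (1 : 𝕜)) x‖ₑ = ∫⁻ y in S, ‖K (x - y)‖ₑ := by
  have hsmul : ∀ y, K (x - y) • S.indicator (fun _ => (1 : 𝕜)) y =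
      ((S.indicator (fun y => K (x - y)) y : ℝ) : 𝕜) := fun y => by
    by_cases hy : y ∈ S <;> simp [hy, RCLike.real_smul_eq_coe_mul]
  have hnn : ∀ y, 0 ≤ S.indicator (fun y => K (x - y)) y :=
    indicator_nonneg fun y _ => hK _
  have hint : Integrable (S.indicator fun y => K (x - y)) := by
    simpa only [hsmul, RCLike.ofReal_re] using hx.re
  simp only [kernelOperator, hsmul]
  rw [integral_ofReal, ← ofReal_norm, RCLike.norm_ofReal, abs_of_nonneg (integral_nonneg hnn),
    ofReal_integral_eq_lintegral_ofReal hint (Filter.Eventually.of_forall hnn),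
    ← lintegral_indicator hS]
  refine lintegral_congr fun y => ?_
  rw [← enorm_indicator_eq_indicator_enorm, Real.enorm_eq_ofReal (hnn y)]

theorem RadiallyDecreasing.volume_ball_mul_enorm_le {K : 𝔼 n → F} (hK : RadiallyDecreasing K)
    {z x : 𝔼 n} [NeZero n] (hx : x ∈ ball 0 (‖z‖ / 2)) :
    volume (ball (0 : 𝔼 n) (‖z‖ / 2)) * ‖K z‖ₑ ≤ ∫⁻ y in ball 0 (‖z‖ / 2), ‖K (x - y)‖ₑ := by
  rw [mul_comm, ← setLIntegral_const]
  refine lintegral_mono_ae ?_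
  filter_upwards [ae_restrict_mem measurableSet_ball,
    ae_restrict_of_ae (Measure.ae_ne volume x)] with y hy hyx
  refine enorm_le_iff_norm_le.2 (hK (sub_ne_zero.2 hyx.symm) ?_)
  linarith [norm_sub_le x y, mem_ball_zero_iff.1 hx, mem_ball_zero_iff.1 hy]

theorem exists_le_mul_morreyOpNorm_of_ae_le (𝕜 : Type*) [RCLike 𝕜] (hp : 0 < p)
    (hφ : IsClassG n p φ) :
    ∃ C : ℝ, 0 < C ∧ ∀ q : ℝ, 0 < q → ∀ ψ : ℝ → ℝ, (∀ r : ℝ, 0 < r → 0 < ψ r) →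
      ∀ (T : (𝔼 n → 𝕜) → 𝔼 n → 𝕜) (b : 𝔼 n) (R : ℝ), 0 < R → ∀ c : ℝ≥0∞,
      (∀ᵐ x ∂volume.restrict (ball b R), c ≤ ‖T ((ball b R).indicator fun _ => 1) x‖ₑ) →
      c ≤ ENNReal.ofReal (C * (ψ R / φ R)) * morreyOpNorm p φ q ψ T := by
  obtain ⟨C, hC, hind⟩ := exists_genMorreyNorm_indicator_ball_le (n := n) 𝕜 hp hφ
  refine ⟨C, hC, fun q hq ψ hψ T b R hR c hc => ?_⟩
  set f : 𝔼 n → 𝕜 := (ball b R).indicator fun _ => 1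
  set P := morreyOpNorm p φ q ψ T
  calc c ≤ ENNReal.ofReal (ψ R) * genMorreyNorm q ψ (T f) :=
        le_mul_genMorreyNorm_of_ae_le hq hψ hR hc
    _ ≤ ENNReal.ofReal (ψ R) * (P * genMorreyNorm p φ f) := by
        gcongr
        exact genMorreyNorm_le_morreyOpNorm_mul (memGenMorrey_indicator_ball 𝕜 hp hφ b hR)
          (genMorreyNorm_indicator_ball_ne_zero 𝕜 hp hφ.pos b hR)
    _ ≤ ENNReal.ofReal (ψ R) * (P * ENNReal.ofReal (C / φ R)) := by
        gcongr
        exact hind b R hR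
    _ = _ := by
        rw [mul_left_comm, ← ENNReal.ofReal_mul (hψ R hR).le, mul_comm, ← mul_div_assoc,
          mul_comm (ψ R), mul_div_assoc]

theorem exists_enorm_kernel_le_morreyOpNorm (𝕜 : Type*) [RCLike 𝕜] [NeZero n] (hp : 0 < p)
    (hφ : IsClassG n p φ) :
    ∃ C : ℝ, 0 < C ∧ ∀ q : ℝ, 0 < q →
      ∀ ψ : ℝ → ℝ, (∀ r : ℝ, 0 < r → ψ r = φ r * r ^ ((n : ℝ) - n / t)) →
      ∀ K : 𝔼 n → ℝ, (∀ x, 0 ≤ K x) → RadiallyDecreasing K →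
      (∀ f : 𝔼 n → 𝕜, MemGenMorrey p φ f → ∀ᵐ x, Integrable fun y => K (x - y) • f y) →
      ∀ z : 𝔼 n, z ≠ 0 → ‖K z‖ₑ ≤ ENNReal.ofReal (C * ‖z‖ ^ (-((n : ℝ) / t))) *
        morreyOpNorm p φ q ψ (kernelOperator (𝕜 := 𝕜) K) := by
  obtain ⟨D, hD, htest⟩ := exists_le_mul_morreyOpNorm_of_ae_le (n := n) 𝕜 hp hφ
  have hω := unitBallVolume_pos n
  refine ⟨(unitBallVolume n)⁻¹ * D * 2 ^ ((n : ℝ) / t), by positivity,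
    fun q hq ψ hψ K hK₀ hK hint z hz => ?_⟩
  have hz₀ : 0 < ‖z‖ := norm_pos_iff.2 hz
  set R := ‖z‖ / 2 with hR_def
  have hR : 0 < R := by positivity
  have hψ₀ : ∀ r : ℝ, 0 < r → 0 < ψ r := fun r hr => by
    have := hφ.pos r hr
    rw [hψ r hr]
    positivity
  have hlow : ∀ᵐ x ∂volume.restrict (ball 0 R), volume (ball (0 : 𝔼 n) R) * ‖K z‖ₑ ≤
      ‖kernelOperator K ((ball 0 R).indicator fun _ => (1 : 𝕜)) x‖ₑ := by
    filter_upwards [ae_restrict_mem measurableSet_ball,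
      ae_restrict_of_ae (hint _ (memGenMorrey_indicator_ball 𝕜 hp hφ 0 hR))] with x hx hi
    rw [enorm_kernelOperator_indicator_one hK₀ measurableSet_ball hi]
    exact hK.volume_ball_mul_enorm_le hx
  have hmean := htest q hq ψ hψ₀ _ 0 R hR _ hlow
  rw [hψ R hR, mul_div_cancel_left₀ _ (hφ.pos R hR).ne', mul_comm (volume _),
    ← ENNReal.le_div_iff_mul_le (Or.inl (measure_ball_pos _ _ hR).ne')
      (Or.inl measure_ball_lt_top.ne)] at hmean
  refine hmean.trans_eq ?_
  rw [volume_ball_eq_ofReal 0 hR, ENNReal.mul_div_right_comm,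
    ← ENNReal.ofReal_div_of_pos (by positivity)]
  congr 2
  rw [sub_eq_add_neg, Real.rpow_add hR, hR_def, Real.div_rpow hz₀.le two_pos.le _,
    Real.div_rpow hz₀.le two_pos.le _, Real.rpow_neg two_pos.le]
  field_simp

theorem exists_morreyNorm_kernel_le_morreyOpNorm (𝕜 : Type*) [RCLike 𝕜] [NeZero n] (hp : 0 < p)
    (hpt : p < t) (hφ : IsClassG n p φ) :
    ∃ C : ℝ, 0 < C ∧ ∀ q : ℝ, 0 < q →
      ∀ ψ : ℝ → ℝ, (∀ r : ℝ, 0 < r → ψ r = φ r * r ^ ((n : ℝ) - n / t)) →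
      ∀ K : 𝔼 n → ℝ, (∀ x, 0 ≤ K x) → RadiallyDecreasing K →
      (∀ f : 𝔼 n → 𝕜, MemGenMorrey p φ f → ∀ᵐ x, Integrable fun y => K (x - y) • f y) →
      ENNReal.ofReal C * morreyNorm p t K ≤
        morreyOpNorm p φ q ψ (kernelOperator (𝕜 := 𝕜) K) := by
  obtain ⟨c, hc, hpow⟩ := exists_morreyNorm_norm_rpow_le (n := n) hp hpt
  obtain ⟨D, hD, hdecay⟩ := exists_enorm_kernel_le_morreyOpNorm (t := t) 𝕜 hp hφ
  refine ⟨(D * c)⁻¹, by positivity, fun q hq ψ hψ K hK₀ hK hint => ?_⟩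
  set P := morreyOpNorm p φ q ψ (kernelOperator (𝕜 := 𝕜) K)
  rcases eq_or_ne P ∞ with hP | hP
  · rw [hP]
    exact le_top
  have hle : ∀ᵐ z : 𝔼 n, ‖K z‖ₑ ≤ ENNReal.ofReal D * P * ‖‖z‖ ^ (-((n : ℝ) / t))‖ₑ := by
    filter_upwards [Measure.ae_ne volume (0 : 𝔼 n)] with z hz
    refine (hdecay q hq ψ hψ K hK₀ hK hint z hz).trans_eq ?_
    rw [ENNReal.ofReal_mul hD.le, Real.enorm_eq_ofReal (by positivity), mul_right_comm]
  rw [ENNReal.ofReal_inv_of_pos (by positivity), ENNReal.inv_mul_le_iff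
    (ENNReal.ofReal_pos.2 (by positivity)).ne' ENNReal.ofReal_ne_top]
  calc morreyNorm p t K ≤ ENNReal.ofReal D * P * ENNReal.ofReal c :=
        (morreyNorm_le_mul hp (ENNReal.mul_ne_top ENNReal.ofReal_ne_top hP) hle).trans
          (mul_le_mul_right hpow _)
    _ = ENNReal.ofReal (D * c) * P := by rw [ENNReal.ofReal_mul hD.le, mul_right_comm]

end LowerBound

section Exponents

variable {p s t : ℝ} {φ : ℝ → ℝ}

theorem div_conjExponent (hs : 1 < s) (c : ℝ) : c / s.conjExponent = c - c / s := by
  have : s - 1 ≠ 0 := by linarith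
  rw [Real.conjExponent]
  field_simp

theorem rpow_neg_one_le_add_of_exponent_le {x r d : ℝ} (hs : 1 < s) (hsp : s ≤ p) (hd : 0 ≤ d)
    (hx : 0 < x) (hr : 0 < r) (hr₁ : r ≤ 1) :
    r ^ (-1 : ℝ) ≤ x ^ p * r ^ (d - 1) +
      r ^ (d - 1) / (x ^ s.conjExponent * r ^ (d * s.conjExponent)) := by
  have hs₀ : 0 < s := by linarith
  have hp : 0 < p := by linarith
  have hs' : 0 < s.conjExponent := div_pos hs₀ (by linarith)
  have hsplit : r ^ (d - 1) = r ^ d * r ^ (-1 : ℝ) := by rw [← Real.rpow_add hr, sub_eq_add_neg]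
  rcases le_total 1 (x * r ^ (d / p)) with hlarge | hsmall
  · have h : 1 ≤ x ^ p * r ^ d := by
      have := Real.one_le_rpow hlarge hp.le
      rwa [Real.mul_rpow hx.le (by positivity), ← Real.rpow_mul hr.le,
        div_mul_cancel₀ _ hp.ne'] at this
    refine le_add_of_le_of_nonneg ?_ (by positivity)
    rw [hsplit, ← mul_assoc]
    exact le_mul_of_one_le_left (by positivity) h
  · have hxs : x * r ^ (d / s) ≤ 1 := le_trans
      (by gcongr x * ?_; exact Real.rpow_le_rpow_of_exponent_ge hr hr₁ (by gcongr)) hsmall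
    have h : x ^ s.conjExponent * r ^ (d * s.conjExponent) ≤ r ^ d := by
      have hexp : d * s.conjExponent = d / s * s.conjExponent + d := by
        have : s - 1 ≠ 0 := by linarith
        rw [Real.conjExponent]
        field_simp
        ring
      rw [hexp, Real.rpow_add hr, ← mul_assoc, Real.rpow_mul hr.le,
        ← Real.mul_rpow hx.le (by positivity)]
      exact mul_le_of_le_one_left (by positivity) (Real.rpow_le_one (by positivity) hxs hs'.le)
    refine le_add_of_nonneg_of_le (by positivity) ?_
    rw [le_div_iff₀ (by positivity), hsplit, mul_comm]
    gcongr

theorem lintegral_Ioo_zero_one_rpow_neg_one :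
    ∫⁻ r in Ioo (0 : ℝ) 1, ENNReal.ofReal (r ^ (-1 : ℝ)) = ∞ := by
  by_contra hfin
  have hint : IntegrableOn (fun r : ℝ => r ^ (-1 : ℝ)) (Ioo 0 1) := by
    refine ⟨(measurable_id.pow_const _).aestronglyMeasurable, ?_⟩
    rw [hasFiniteIntegral_iff_ofReal]
    · exact lt_top_iff_ne_top.2 hfin
    · filter_upwards [ae_restrict_mem measurableSet_Ioo] with r hr
      exact Real.rpow_nonneg hr.1.le _
  rw [intervalIntegral.integrableOn_Ioo_rpow_iff one_pos] at hint
  exact lt_irrefl _ hint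

theorem lt_of_lintegral_Ioo_ne_top {d : ℝ} (hs : 1 < s) (hd : 0 ≤ d)
    (hφ : ∀ r : ℝ, 0 < r → 0 < φ r) (hm : AEMeasurable φ (volume.restrict (Ioi (0 : ℝ))))
    (h₁ : ∫⁻ r in Ioo 0 1, ENNReal.ofReal (φ r ^ p * r ^ (d - 1)) ≠ ∞)
    (h₂ : ∫⁻ r in Ioo 0 1, ENNReal.ofReal
      (r ^ (d - 1) / (φ r ^ s.conjExponent * r ^ (d * s.conjExponent))) ≠ ∞) :
    p < s := by
  by_contra! hsp
  have hm₁ : AEMeasurable (fun r => ENNReal.ofReal (φ r ^ p * r ^ (d - 1)))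
      (volume.restrict (Ioo (0 : ℝ) 1)) :=
    (((hm.mono_measure (Measure.restrict_mono Ioo_subset_Ioi_self le_rfl)).pow_const p).mul
      (measurable_id.pow_const _).aemeasurable).ennreal_ofReal
  have hle := (setLIntegral_mono' measurableSet_Ioo fun r (hr : r ∈ Ioo (0 : ℝ) 1) =>
    (ENNReal.ofReal_le_ofReal (rpow_neg_one_le_add_of_exponent_le hs hsp hd (hφ r hr.1) hr.1
      hr.2.le)).trans ENNReal.ofReal_add_le).trans_eq (lintegral_add_left' hm₁ _)
  rw [lintegral_Ioo_zero_one_rpow_neg_one, top_le_iff] at hle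
  exact ENNReal.add_ne_top.2 ⟨h₁, h₂⟩ hle

theorem one_le_of_one_div_eq_add_one_div_sub_one {d α q : ℝ} (hp : 1 ≤ p) (hs : 1 < s)
    (hst : s ≤ t) (hd : 0 < d) (hpα : p < d / α) (ht : t ≤ d / (d - α))
    (hq : 1 / q = 1 / p + 1 / s - 1) : 1 ≤ q := by
  have hp₀ : 0 < p := by linarith
  have hs₀ : 0 < s := by linarith
  have hsd : 1 / s ≥ 1 - α / d := by
    rw [one_sub_div hd.ne', ge_iff_le, ← one_div_div d]
    exact one_div_le_one_div_of_le hs₀ (hst.trans ht)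
  have hpd : α / d < 1 / p := by
    rw [← one_div_div]
    exact one_div_lt_one_div_of_lt hp₀ hpα
  have hq₀ : 0 < q := one_div_pos.1 (by linarith)
  have hp₁ : 1 / p ≤ 1 := (div_le_one hp₀).2 hp
  have hs₁ : 1 / s ≤ 1 := (div_le_one hs₀).2 hs.le
  rw [← div_le_one hq₀]
  linarith

end Exponents

theorem theorem3p1_general (𝕜 : Type*) [RCLike 𝕜] (n : ℕ) (p₁ s t : ℝ) (φ : ℝ → ℝ)
    (hp₁ : 1 ≤ p₁) (hs : 1 < s) (hst : s ≤ t) (hp₁t : p₁ < t) (hφ : IsClassG n p₁ φ)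
    (h_i : HasDominatedTail ((n : ℝ) / t.conjExponent) φ) :
    ∃ C₄ C₅ : ℝ, 0 < C₄ ∧ 0 < C₅ ∧ ∀ α γ p₂ : ℝ, ∀ ψ : ℝ → ℝ, α < n → 0 ≤ γ → p₁ < n / α →
      ((s < t ∧ t = n / (n - α)) ∨ (n / (n + γ - α) < t ∧ t < n / (n - α))) →
      1 / p₂ = 1 / p₁ - 1 / s.conjExponent →
      (∀ r : ℝ, 0 < r → ψ r = φ r * r ^ ((n : ℝ) / t.conjExponent)) →
      (∀ f : 𝔼 n → 𝕜, MemGenMorrey p₁ φ f →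
        (∀ᵐ x, Integrable fun y => besselRieszKernel α γ (x - y) • f y) ∧
          MemGenMorrey p₂ ψ (besselRiesz α γ f)) ∧
      morreyNorm s t (besselRieszKernel (n := n) α γ) < ∞ ∧
      ENNReal.ofReal C₄ * morreyNorm p₁ t (besselRieszKernel (n := n) α γ) ≤
        morreyOpNorm p₁ φ p₂ ψ (besselRiesz (n := n) (𝕜 := 𝕜) α γ) ∧
      morreyOpNorm p₁ φ p₂ ψ (besselRiesz (n := n) (𝕜 := 𝕜) α γ) ≤
        ENNReal.ofReal C₅ * morreyNorm s t (besselRieszKernel (n := n) α γ) := by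
  have ht : 1 < t := hs.trans_le hst
  simp only [div_conjExponent ht, div_conjExponent hs] at h_i ⊢
  rcases eq_or_ne n 0 with rfl | hn
  · refine ⟨1, 1, one_pos, one_pos, fun α γ p₂ ψ _ _ hpα => ?_⟩
    rw [Nat.cast_zero, zero_div] at hpα
    linarith
  have : NeZero n := ⟨hn⟩
  have hn₀ : (0 : ℝ) < n := mod_cast NeZero.pos n
  obtain ⟨C₅, hC₅, hupper⟩ := exists_kernelOperator_bounded 𝕜 hp₁ hs.le (by linarith) hφ.pos
    hφ.almostDecreasing h_i
  obtain ⟨C₄, hC₄, hlower⟩ := exists_morreyNorm_kernel_le_morreyOpNorm 𝕜 (by linarith) hp₁t hφ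
  refine ⟨C₄, C₅, hC₄, hC₅, fun α γ p₂ ψ hα hγ hpα hab hp₂ hψ => ?_⟩
  have hq : 1 / p₂ = 1 / p₁ + 1 / s - 1 := by
    rw [hp₂]
    ring
  have hp₂_one : 1 ≤ p₂ := one_le_of_one_div_eq_add_one_div_sub_one hp₁ hs hst hn₀ hpα
    (hab.elim (fun h => h.2.le) fun h => h.2.le) hq
  have hK : RadiallyDecreasing (besselRieszKernel α γ : 𝔼 n → ℝ) :=
    radiallyDecreasing_besselRieszKernel hα.le hγ
  have hM := morreyNorm_besselRieszKernel_lt_top hα hγ (by linarith) hst hab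
  have hT := hupper p₂ hp₂_one hq ψ hψ _ measurable_besselRieszKernel hK hM
  exact ⟨fun f hf => ⟨(hT f hf).1, (hT f hf).2.1⟩, hM,
    hlower p₂ (by linarith) ψ hψ _ besselRieszKernel_nonneg hK fun f hf => (hT f hf).1,
    morreyOpNorm_le fun f hf => (hT f hf).2.2⟩

theorem rieszKernel_eq_besselRieszKernel_zero (α : ℝ) :
    (rieszKernel α : 𝔼 n → ℝ) = besselRieszKernel α 0 := by
  ext x
  simp [rieszKernel, besselRieszKernel]

theorem fractionalIntegral_eq_besselRiesz_zero (𝕜 : Type*) [RCLike 𝕜] (α : ℝ) :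
    (fractionalIntegral α : (𝔼 n → 𝕜) → 𝔼 n → 𝕜) = besselRiesz α 0 := by
  ext f x
  simp only [fractionalIntegral, besselRiesz, rieszKernel_eq_besselRieszKernel_zero]

end

theorem theorem3p1 (𝕜 : Type*) [RCLike 𝕜] (n : ℕ) (p₁ s t : ℝ) (φ : ℝ → ℝ)
    (hp₁ : 1 ≤ p₁) (hs : 1 < s) (hst : s ≤ t)
    (hφ : IsClassG n p₁ φ)
    (hρ : AlmostIncreasing fun r => φ r * r ^ (n : ℝ))
    (h_i : ∃ C₁ : ℝ, 0 < C₁ ∧ ∀ R : ℝ, 0 < R →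
      ∫⁻ r in Ioi R, ENNReal.ofReal (φ r * r ^ ((n : ℝ) / t.conjExponent - 1)) ≤
        ENNReal.ofReal (C₁ * (φ R * R ^ ((n : ℝ) / t.conjExponent))))
    (h_ii : ∃ C₂ : ℝ, 0 < C₂ ∧ ∀ R : ℝ, 0 < R →
      ∫⁻ r in Ioo 0 R, ENNReal.ofReal (φ r ^ p₁ * r ^ ((n : ℝ) - 1)) ≤
        ENNReal.ofReal (C₂ * (φ R ^ p₁ * R ^ (n : ℝ))))
    (h_iii : ∃ C₃ : ℝ, 0 < C₃ ∧ ∀ R : ℝ, 0 < R →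
      ∫⁻ r in Ioo 0 R, ENNReal.ofReal
          (r ^ ((n : ℝ) - 1) / (φ r ^ s.conjExponent * r ^ ((n : ℝ) * s.conjExponent))) ≤
        ENNReal.ofReal
          (C₃ * R ^ (n : ℝ) / (φ R ^ s.conjExponent * R ^ ((n : ℝ) * s.conjExponent)))) :
    -- the constants depend on `φ, n, p₁, s, t` but not on `α` and `γ`
    ∃ C₄ C₅ : ℝ, 0 < C₄ ∧ 0 < C₅ ∧
      (∀ α γ p₂ : ℝ, ∀ ψ : ℝ → ℝ, 0 < α → α < n → 0 ≤ γ → p₁ < n / α →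
        ((p₁ < t ∧ s < t ∧ t = n / (n - α)) ∨
          (0 < γ ∧ p₁ ≤ t ∧ n / (n + γ - α) < t ∧ t < n / (n - α))) →
        1 / p₂ = 1 / p₁ - 1 / s.conjExponent →
        (∀ r : ℝ, 0 < r → ψ r = φ r * r ^ ((n : ℝ) / t.conjExponent)) →
        -- the operator is well defined on the whole space, and the norms are finite
        (∀ f : EuclideanSpace ℝ (Fin n) → 𝕜, MemGenMorrey p₁ φ f →
          (∀ᵐ x, Integrable fun y => besselRieszKernel α γ (x - y) • f y) ∧
            MemGenMorrey p₂ ψ (besselRiesz α γ f)) ∧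
        morreyNorm s t (besselRieszKernel (n := n) α γ) < ∞ ∧
        ENNReal.ofReal C₄ * morreyNorm p₁ t (besselRieszKernel (n := n) α γ) ≤
          morreyOpNorm p₁ φ p₂ ψ (besselRiesz (n := n) (𝕜 := 𝕜) α γ) ∧
        morreyOpNorm p₁ φ p₂ ψ (besselRiesz (n := n) (𝕜 := 𝕜) α γ) ≤
          ENNReal.ofReal C₅ * morreyNorm s t (besselRieszKernel (n := n) α γ)) ∧
      (∀ α p₂ : ℝ, ∀ ψ : ℝ → ℝ, 0 < α → α < n → p₁ < n / α →
        p₁ < t → s < t → t = n / (n - α) →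
        1 / p₂ = 1 / p₁ - 1 / s.conjExponent →
        (∀ r : ℝ, 0 < r → ψ r = φ r * r ^ ((n : ℝ) / t.conjExponent)) →
        ENNReal.ofReal C₄ * morreyNorm p₁ t (rieszKernel (n := n) α) ≤
          morreyOpNorm p₁ φ p₂ ψ (fractionalIntegral (n := n) (𝕜 := 𝕜) α) ∧
        morreyOpNorm p₁ φ p₂ ψ (fractionalIntegral (n := n) (𝕜 := 𝕜) α) ≤
          ENNReal.ofReal C₅ * morreyNorm s t (rieszKernel (n := n) α)) := by
  have hp₁s : p₁ < s := by
    obtain ⟨C₂, -, h₂⟩ := h_ii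
    obtain ⟨C₃, -, h₃⟩ := h_iii
    exact lt_of_lintegral_Ioo_ne_top hs n.cast_nonneg hφ.pos hφ.aemeasurable
      ((h₂ 1 one_pos).trans_lt ENNReal.ofReal_lt_top).ne
      ((h₃ 1 one_pos).trans_lt ENNReal.ofReal_lt_top).ne
  obtain ⟨C₄, C₅, hC₄, hC₅, h⟩ :=
    theorem3p1_general 𝕜 n p₁ s t φ hp₁ hs hst (hp₁s.trans_le hst) hφ h_i
  refine ⟨C₄, C₅, hC₄, hC₅, fun α γ p₂ ψ _ hα hγ hpα hab => h α γ p₂ ψ hα hγ hpα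
    (hab.imp And.right fun hb => hb.2.2), fun α p₂ ψ _ hα hpα _ hst' ht hp₂ hψ => ?_⟩
  rw [rieszKernel_eq_besselRieszKernel_zero, fractionalIntegral_eq_besselRiesz_zero]
  exact (h α 0 p₂ ψ hα le_rfl hpα (Or.inl ⟨hst', ht⟩) hp₂ hψ).2.2
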